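/- **Theorem 6.6.** Let $\Gamma$ be a countably infinite discrete group with identity $e$ and let $\mu$ be a probability measure on $\Gamma$ that is finitely supported, admissible (its support generates $\Gamma$ as a semigroup) and lazy ($\mu(e)>0$). Put $P(x,y)=\mu(x^{-1}y)$, let $P^n$ be the $n$-step transition probabilities, $\rho=\limsup_n P^n(e,e)^{1/n}$, $R=\rho^{-1}$, and $|x|=\min\{n\ge 0: P^n(e,x)>0\}$. *Conventions.* Given a kernel $K(x,y)$ on a countable set $\Omega$, the Martin compactification of $\Omega$ is the smallest compactification in which $\Omega$ is discrete, open and dense and to which all functions $K(x,\cdot)$ extend continuously; the Martin boundary is the complement of $\Omega$ in it. For a non-negative kernel $Q$ on $\Omega$ with base point $x_0$, a non-negative function $h$ with $h(x_0)=1$ and $Qh=th$ is called minimal $t$-harmonic if every $g\ge 0$ with $Qg=tg$ and $g\le Ch$ for some constant $C>0$ is a non-negative multiple of $h$. The minimal Martin boundary is the set of boundary points $\xi$ for which $K(\cdot,\xi)$ is minimal. * For $0<\lambda<R$ let $G(x,y\,|\,\lambda)=\sum_{n\ge0}\lambda^nP^n(x,y)$ and $K(x,y\,|\,\lambda)=G(x,y\,|\,\lambda)/G(e,y\,|\,\lambda)$,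 and let $K(x,y\,|\,R)=\lim_{\lambda\uparrow R}K(x,y\,|\,\lambda)$. For $0<\lambda\le R$, $\partial^m_{M,\lambda}\Gamma$ is the minimal Martin boundary for the kernel $K(\cdot,\cdot\,|\,\lambda)$, minimality being that of $\lambda^{-1}$-harmonic functions of $P$ with base point $e$. * Let $\bar\mu_x(y)=\mu(x^{-1}y)$ if $|y|\ge|x|+1$ and $\bar\mu_x(y)=0$ otherwise. $\partial^m_{M,0}\Gamma$ is the minimal Martin boundary for $K(x,y\,|\,0)=G_{\bar\mu}(x,y)/G_{\bar\mu}(e,y)$, where $G_{\bar\mu}=\sum_n\bar\mu^n$, minimality being that of $1$-harmonic functions of $\bar\mu$ with base point $e$. * The space-time set is $\mathrm{ST}=\{(x,n)\in\Gamma\times\mathbb{Z}_{\ge 0}: P^n(e,x)>0\}$, with the Markov kernel $P_{\mathrm{ST}}((x,m),(y,n))=\delta_{m+1,n}\,\mu(x^{-1}y)$, Green function $G_{\mathrm{ST}}=\sum_k P_{\mathrm{ST}}^k$ and Martin kernel $K_{\mathrm{ST}}(p,q)=G_{\mathrm{ST}}(p,q)/G_{\mathrm{ST}}((e,0),q)$.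 $\partial^m_{\mathrm{ST}}\Gamma$ is the corresponding minimal Martin boundary ($1$-harmonic functions of $P_{\mathrm{ST}}$, base point $(e,0)$), with the topology of the Martin compactification. Let $\tilde K(x,\xi\,|\,\lambda)=\lambda^{|x|}K(x,\xi\,|\,\lambda)$ for $\lambda>0$ and $\tilde K(x,\xi\,|\,0)=K(x,\xi\,|\,0)$. Equip $\bigsqcup_{\lambda\in[0,R]}\partial^m_{M,\lambda}\Gamma$ with the topology of pointwise convergence, i.e. the initial topology of the maps $(\lambda,\xi)\mapsto\lambda$ and $(\lambda,\xi)\mapsto\tilde K(x,\xi\,|\,\lambda)$, $x\in\Gamma$: $(\lambda_n,\xi_n)\to(\lambda,\xi)$ if and only if $\lambda_n\to\lambda$ and $\tilde K(x,\xi_n\,|\,\lambda_n)\to\tilde K(x,\xi\,|\,\lambda)$ for every $x\in\Gamma$. Then the minimal space-time Martin boundary is homeomorphic to this disjoint union, $$\partial^m_{\mathrm{ST}}\Gamma\;\cong\;\bigsqcup_{\lambda\in[0,R]}\partial^m_{M,\lambda}\Gamma ,$$ by a homeomorphism that sends $\eta$ to the point $(\lambda,\xi)$ with, for all $(x,m)\in\mathrm{ST}$,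 $K_{\mathrm{ST}}((x,m),\eta)=\lambda^mK(x,\xi\,|\,\lambda)$ if $\lambda>0$, and $K_{\mathrm{ST}}((x,m),\eta)=\mathbf 1_{m=|x|}K(x,\xi\,|\,0)$ if $\lambda=0$. -/

import Mathlib

open Filter Topology

noncomputable section

/-! ## Kernels on a discrete state space, harmonic functions, Martin boundaries -/

open Classical in
/-- The `n`-step kernel `P^n(x, y)` of a kernel `P` on a discrete space. -/
def stepProb {Ω : Type*} (P : Ω → Ω → ℝ) : ℕ → Ω → Ω → ℝ
  | 0 => fun x y => if x = y then 1 else 0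
  | n + 1 => fun x y => ∑' z, P x z * stepProb P n z y

/-- The Green function `G(x, y | t) = ∑ₙ tⁿ Pⁿ(x, y)`. -/
def green {Ω : Type*} (P : Ω → Ω → ℝ) (t : ℝ) (x y : Ω) : ℝ :=
  ∑' n : ℕ, t ^ n * stepProb P n x y

/-- The ratio `G(x, y | t) / G(x₀, y | t)`. For `t = 1` and a transient chain accessible from
`x₀` this is the Martin kernel of the chain. -/
def greenRatio {Ω : Type*} (P : Ω → Ω → ℝ) (x₀ : Ω) (t : ℝ) (x y : Ω) : ℝ :=
  green P t x y / green P t x₀ y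

open Classical in
/-- The map `y ↦ (K(·, y), δ_·(y))` of a discrete space `Ω` into a product space. -/
def martinEmbedding {Ω : Type*} (K : Ω → Ω → ℝ) (y : Ω) : (Ω → ℝ) × (Ω → ℝ) :=
  (fun x => K x y, fun x => if x = y then 1 else 0)

/-- The Martin compactification of `Ω` with respect to the kernels `K(x, ·)`, as the closure of
the image of `Ω` in the product space: the smallest compactification of the discrete space `Ω`
in which `Ω` is open and to which all functions `K(x, ·)` extend continuously. -/
def martinCompactification {Ω : Type*} (K : Ω → Ω → ℝ) : Set ((Ω → ℝ) × (Ω → ℝ)) :=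
  closure (Set.range (martinEmbedding K))

/-- The Martin boundary: what the compactification adds to `Ω`. The value `K(x, ξ)` of the
extended kernel at a point `ξ` is the coordinate `ξ.1 x`. -/
def martinBoundary {Ω : Type*} (K : Ω → Ω → ℝ) : Set ((Ω → ℝ) × (Ω → ℝ)) :=
  martinCompactification K \ Set.range (martinEmbedding K)

/-- `P f = t f`. -/
def IsHarmonic {Ω : Type*} (P : Ω → Ω → ℝ) (t : ℝ) (f : Ω → ℝ) : Prop :=
  ∀ x, ∑' y, P x y * f y = t * f x

/-- `h` is a non-negative `t`-harmonic function with `h(x₀) = 1` and every non-negative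
`t`-harmonic function dominated by a multiple of `h` is a multiple of `h`. -/
structure IsMinimalHarmonic {Ω : Type*} (P : Ω → Ω → ℝ) (t : ℝ) (x₀ : Ω) (h : Ω → ℝ) :
    Prop where
  nonneg : ∀ x, 0 ≤ h x
  harmonic : IsHarmonic P t h
  normalized : h x₀ = 1
  minimal : ∀ g : Ω → ℝ, (∀ x, 0 ≤ g x) → IsHarmonic P t g →
    (∃ C : ℝ, 0 < C ∧ ∀ x, g x ≤ C * h x) → ∃ c : ℝ, 0 ≤ c ∧ ∀ x, g x = c * h x

/-- The points `ξ` of the Martin boundary of `K` for which `K(·, ξ)` is minimal `t`-harmonic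
for `P`. -/
def minimalMartinBoundary {Ω : Type*} (K : Ω → Ω → ℝ) (P : Ω → Ω → ℝ) (t : ℝ) (x₀ : Ω) :
    Set ((Ω → ℝ) × (Ω → ℝ)) :=
  {ξ | ξ ∈ martinBoundary K ∧ IsMinimalHarmonic P t x₀ ξ.1}

/-! ## The random walk and its `r`-Martin boundaries for `0 < r ≤ R` -/

/-- The transition kernel `P(x, y) = μ(x⁻¹ y)` of the random walk. -/
def walkKernel {Γ : Type*} [Group Γ] (μ : Γ → ℝ) (x y : Γ) : ℝ := μ (x⁻¹ * y)

/-- The spectral radius `ρ = limsup Pⁿ(e, e)^(1/n)`. -/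
def spectralRad {Γ : Type*} [Group Γ] (μ : Γ → ℝ) : ℝ :=
  limsup (fun n : ℕ => stepProb (walkKernel μ) n 1 1 ^ (1 / (n : ℝ))) atTop

/-- `R = ρ⁻¹`. -/
def convRadius {Γ : Type*} [Group Γ] (μ : Γ → ℝ) : ℝ := (spectralRad μ)⁻¹

/-- The Martin kernel `K(x, y | r)` for `0 < r ≤ R`. At `r = R`, where the Green function may be
infinite, it is the limit of the kernels as the parameter increases to `R`. -/
def walkMartinKernel {Γ : Type*} [Group Γ] (μ : Γ → ℝ) (r : ℝ) (x y : Γ) : ℝ :=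
  if r < convRadius μ then greenRatio (walkKernel μ) 1 r x y
  else limUnder (𝓝[<] convRadius μ) (fun s => greenRatio (walkKernel μ) 1 s x y)

/-! ## The `0`-Martin boundary -/

/-- The word norm `|x|_μ = inf {n | Pⁿ(e, x) > 0}`. -/
def wordNorm {Γ : Type*} [Group Γ] (μ : Γ → ℝ) (x : Γ) : ℕ :=
  sInf {n : ℕ | 0 < stepProb (walkKernel μ) n 1 x}

/-- The kernel `μ̄_x(y)`, the random walk killed unless it increases the word norm. -/
def truncKernel {Γ : Type*} [Group Γ] (μ : Γ → ℝ) (x y : Γ) : ℝ :=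
  if wordNorm μ x + 1 ≤ wordNorm μ y then μ (x⁻¹ * y) else 0

/-- The minimal `r`-Martin boundary for `r ∈ [0, R]`. For `r > 0` it consists of the boundary
points `ξ` with `K(·, ξ | r)` minimal `r⁻¹`-harmonic for the random walk; for `r = 0` it is the
minimal Martin boundary of the sub-Markov chain `μ̄`. -/
def minimalBoundaryAt {Γ : Type*} [Group Γ] (μ : Γ → ℝ) (r : ℝ) : Set ((Γ → ℝ) × (Γ → ℝ)) :=
  if r = 0 then
    minimalMartinBoundary (greenRatio (truncKernel μ) 1 1) (truncKernel μ) 1 1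
  else
    minimalMartinBoundary (walkMartinKernel μ r) (walkKernel μ) r⁻¹ 1

/-! ## The disjoint union of the minimal boundaries -/

/-- The disjoint union over `r ∈ [0, R]` of the minimal `r`-Martin boundaries. -/
structure MinimalBoundaryUnion {Γ : Type*} [Group Γ] (μ : Γ → ℝ) where
  param : ℝ
  param_mem : param ∈ Set.Icc 0 (convRadius μ)
  point : (Γ → ℝ) × (Γ → ℝ)
  point_mem : point ∈ minimalBoundaryAt μ param

namespace MinimalBoundaryUnion

/-- `K(x, ξ | r)` at the point `(r, ξ)` of the union. -/
def kernel {Γ : Type*} [Group Γ] {μ : Γ → ℝ} (p : MinimalBoundaryUnion μ) (x : Γ) : ℝ :=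
  p.point.1 x

/-- The rescaled kernel `K̃(x, ξ | r)`: it is `r^|x| K(x, ξ | r)` for `r > 0` and `K(x, ξ | 0)`
for `r = 0`. -/
def rescaledKernel {Γ : Type*} [Group Γ] {μ : Γ → ℝ} (p : MinimalBoundaryUnion μ) (x : Γ) : ℝ :=
  if p.param = 0 then p.kernel x else p.param ^ wordNorm μ x * p.kernel x

/-- The topology of convergence of `r` and pointwise convergence of the rescaled kernels. -/
instance {Γ : Type*} [Group Γ] {μ : Γ → ℝ} : TopologicalSpace (MinimalBoundaryUnion μ) :=
  TopologicalSpace.induced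
    (fun p => ((p.param, p.rescaledKernel) : ℝ × (Γ → ℝ))) inferInstance

/-- The function `f_{r, ξ}(x, m)` of space and time attached to a point of the union:
`r^m K(x, ξ | r)` for `r > 0`, and `1_{m = |x|} K(x, ξ | 0)` for `r = 0`. -/
def spaceTimeFun {Γ : Type*} [Group Γ] {μ : Γ → ℝ} (p : MinimalBoundaryUnion μ)
    (x : Γ) (m : ℕ) : ℝ :=
  if p.param = 0 then (if m = wordNorm μ x then p.kernel x else 0)
  else p.param ^ m * p.kernel x

end MinimalBoundaryUnion

/-! ## The space-time chain -/

/-- The space-time set: pairs `(x, n)` with `Pⁿ(e, x) > 0`. -/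
def SpaceTime {Γ : Type*} [Group Γ] (μ : Γ → ℝ) : Type _ :=
  {p : Γ × ℕ // 0 < stepProb (walkKernel μ) p.2 1 p.1}

/-- The base point `(e, 0)`. -/
def SpaceTime.base {Γ : Type*} [Group Γ] (μ : Γ → ℝ) : SpaceTime μ :=
  ⟨(1, 0), by simp [stepProb]⟩

/-- The transition kernel of the space-time chain, `δ_{m+1,n} μ(x⁻¹ y)`. -/
def spaceTimeKernel {Γ : Type*} [Group Γ] (μ : Γ → ℝ) (p q : SpaceTime μ) : ℝ :=
  if p.1.2 + 1 = q.1.2 then μ (p.1.1⁻¹ * q.1.1) else 0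

/-- The minimal space-time Martin boundary, with the topology of the Martin compactification. -/
def minimalSpaceTimeBoundary {Γ : Type*} [Group Γ] (μ : Γ → ℝ) :
    Set ((SpaceTime μ → ℝ) × (SpaceTime μ → ℝ)) :=
  minimalMartinBoundary (greenRatio (spaceTimeKernel μ) (SpaceTime.base μ) 1)
    (spaceTimeKernel μ) 1 (SpaceTime.base μ)

end

/-! Laziness makes the space-time set equal to `{(x, m) | |x| ≤ m}`, and it gives `μ(e) f(x, m+1) ≤
f(x, m)` for every non-negative space-time harmonic `f`. The time shift of `f` is again harmonic, so
if `f` is minimal the shift is a multiple `r f`. Hence `f(x, m) = r^(m-|x|) H(x)` with `r = f(e, 1)`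
and `H(x) = f(x, |x|)` (`eq_lift_of_isMinimalHarmonic`). Such an `f` is harmonic exactly when `H` is
harmonic for `rescaledWalk μ r`. For `r > 0` this kernel is the walk conjugated by `r^|x|`, so `H =
r^|x| h` with `h` an `r⁻¹`-harmonic function, and this forces `r ≤ R`. For `r = 0` it is the
truncated kernel.

Minimality must also pass back from `H` to `f` (`isMinimalHarmonic_lift_iff`). A harmonic competitor
`g ≤ C f` need not be minimal, but it lies in the compact convex set of harmonic functions between
`0` and `C f`. A perturbation by the time shift shows that extreme points of this set satisfy `g(x,
m+1) = r g(x, m)`, and Krein–Milman extends the relation to the whole set (`next_eq_of_le`).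

It remains to see that minimal functions really come from Martin boundary points. For a transient
kernel with finite rows, a minimal `h` is a limit of potentials with charges escaping every finite
set. Minimality forces the variance of the kernels `K(x, ·)` under these charges to vanish, so
single kernels already approximate `h` (`exists_kernel_approx`). At `r = R` in the recurrent case,
`K(x, y | R) = h(x)` for all `y`.

A boundary point is determined by its kernel, and both topologies are pointwise convergence, so the
explicit formulas are continuous in both directions. -/

/-- The action `f ↦ P f` of a kernel on functions. -/
noncomputable def kernelOp {Ω : Type*} (P : Ω → Ω → ℝ) (f : Ω → ℝ) (x : Ω) : ℝ := ∑' y, P x y * f y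

/-- A non-negative kernel all of whose rows have finite support. -/
structure IsFiniteKernel {Ω : Type*} (P : Ω → Ω → ℝ) : Prop where
  nonneg : ∀ x y, 0 ≤ P x y
  finite : ∀ x, (Function.support (P x)).Finite

/-! ### Iterates of kernels with finite rows. -/

namespace IsFiniteKernel

variable {Ω : Type*} {P : Ω → Ω → ℝ}

/-- The support of a row. -/
noncomputable def row (hP : IsFiniteKernel P) (x : Ω) : Finset Ω := (hP.finite x).toFinset

lemma eq_zero_of_notMem_row (hP : IsFiniteKernel P) {x y : Ω} (h : y ∉ hP.row x) : P x y = 0 := by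
  simpa [row] using h

lemma kernelOp_eq_sum (hP : IsFiniteKernel P) (f : Ω → ℝ) (x : Ω) :
    kernelOp P f x = ∑ y ∈ hP.row x, P x y * f y :=
  tsum_eq_sum fun y hy => by rw [hP.eq_zero_of_notMem_row hy, zero_mul]

lemma summable (hP : IsFiniteKernel P) (f : Ω → ℝ) (x : Ω) : Summable fun y => P x y * f y :=
  summable_of_ne_finset_zero (s := hP.row x) fun y hy => by
    rw [hP.eq_zero_of_notMem_row hy, zero_mul]

lemma kernelOp_add (hP : IsFiniteKernel P) (f g : Ω → ℝ) :
    kernelOp P (fun x => f x + g x) = fun x => kernelOp P f x + kernelOp P g x := by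
  ext x; simp only [hP.kernelOp_eq_sum, mul_add, Finset.sum_add_distrib]

lemma kernelOp_sub (hP : IsFiniteKernel P) (f g : Ω → ℝ) :
    kernelOp P (fun x => f x - g x) = fun x => kernelOp P f x - kernelOp P g x := by
  ext x; simp only [hP.kernelOp_eq_sum, mul_sub, Finset.sum_sub_distrib]

lemma kernelOp_smul (hP : IsFiniteKernel P) (c : ℝ) (f : Ω → ℝ) :
    kernelOp P (fun x => c * f x) = fun x => c * kernelOp P f x := by
  ext x; simp only [hP.kernelOp_eq_sum, Finset.mul_sum]
  exact Finset.sum_congr rfl fun y _ => by ring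

lemma kernelOp_sum (hP : IsFiniteKernel P) {ι : Type*} (s : Finset ι) (f : ι → Ω → ℝ) :
    kernelOp P (fun x => ∑ i ∈ s, f i x) = fun x => ∑ i ∈ s, kernelOp P (f i) x := by
  ext x; simp only [hP.kernelOp_eq_sum, Finset.mul_sum]
  exact Finset.sum_comm

lemma kernelOp_mono (hP : IsFiniteKernel P) {f g : Ω → ℝ} (h : ∀ x, f x ≤ g x) (x : Ω) :
    kernelOp P f x ≤ kernelOp P g x := by
  simp only [hP.kernelOp_eq_sum]
  exact Finset.sum_le_sum fun y _ => mul_le_mul_of_nonneg_left (h y) (hP.nonneg x y)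

lemma kernelOp_nonneg (hP : IsFiniteKernel P) {f : Ω → ℝ} (h : ∀ x, 0 ≤ f x) (x : Ω) :
    0 ≤ kernelOp P f x :=
  tsum_nonneg fun y => mul_nonneg (hP.nonneg x y) (h y)

lemma mul_le_kernelOp (hP : IsFiniteKernel P) {f : Ω → ℝ} (h : ∀ x, 0 ≤ f x) (x y : Ω) :
    P x y * f y ≤ kernelOp P f x :=
  (hP.summable f x).le_tsum y fun z _ => mul_nonneg (hP.nonneg x z) (h z)

lemma iterate_mono (hP : IsFiniteKernel P) {f g : Ω → ℝ} (h : ∀ x, f x ≤ g x) (n : ℕ) :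
    ∀ x, (kernelOp P)^[n] f x ≤ (kernelOp P)^[n] g x := by
  induction n with
  | zero => simpa using h
  | succ n ih => intro x; simp only [Function.iterate_succ_apply']; exact hP.kernelOp_mono ih x

lemma iterate_nonneg (hP : IsFiniteKernel P) {f : Ω → ℝ} (h : ∀ x, 0 ≤ f x) (n : ℕ) :
    ∀ x, 0 ≤ (kernelOp P)^[n] f x := by
  induction n with
  | zero => simpa using h
  | succ n ih => intro x; simp only [Function.iterate_succ_apply']; exact hP.kernelOp_nonneg ih x

lemma iterate_sum (hP : IsFiniteKernel P) {ι : Type*} (s : Finset ι) (c : ι → ℝ) (f : ι → Ω → ℝ)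
    (n : ℕ) : (kernelOp P)^[n] (fun x => ∑ i ∈ s, c i * f i x) =
      fun x => ∑ i ∈ s, c i * (kernelOp P)^[n] (f i) x := by
  induction n with
  | zero => rfl
  | succ n ih =>
    simp only [Function.iterate_succ_apply']
    rw [ih, hP.kernelOp_sum]
    ext x
    exact Finset.sum_congr rfl fun i _ => by rw [hP.kernelOp_smul]

open Classical in
lemma stepProb_eq_iterate (P : Ω → Ω → ℝ) (n : ℕ) (y : Ω) :
    (fun x => stepProb P n x y) = (kernelOp P)^[n] (fun x => if x = y then 1 else 0) := by
  induction n with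
  | zero => rfl
  | succ n ih => rw [Function.iterate_succ_apply', ← ih]; rfl

lemma stepProb_nonneg (hP : IsFiniteKernel P) (n : ℕ) (x y : Ω) : 0 ≤ stepProb P n x y := by
  rw [show stepProb P n x y = _ from congrFun (stepProb_eq_iterate P n y) x]
  exact hP.iterate_nonneg (fun x => by split_ifs <;> norm_num) n x

lemma stepProb_finite (hP : IsFiniteKernel P) (n : ℕ) (x : Ω) :
    (Function.support (stepProb P n x)).Finite := by
  induction n generalizing x with
  | zero =>
    refine (Set.finite_singleton x).subset fun y hy => ?_
    simp only [Function.mem_support, stepProb] at hy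
    by_contra h
    exact hy (if_neg fun h' => h h'.symm)
  | succ n ih =>
    refine ((hP.row x).finite_toSet.biUnion fun z _ => ih z).subset fun y hy => ?_
    have : stepProb P (n + 1) x y = ∑ z ∈ hP.row x, P x z * stepProb P n z y :=
      hP.kernelOp_eq_sum (fun z => stepProb P n z y) x
    rw [Function.mem_support, this] at hy
    obtain ⟨z, hz, hz'⟩ := Finset.exists_ne_zero_of_sum_ne_zero hy
    exact Set.mem_biUnion hz (right_ne_zero_of_mul hz')

lemma isFiniteKernel_stepProb (hP : IsFiniteKernel P) (n : ℕ) : IsFiniteKernel (stepProb P n) :=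
  ⟨hP.stepProb_nonneg n, hP.stepProb_finite n⟩

open Classical in
lemma iterate_eq (hP : IsFiniteKernel P) (n : ℕ) (f : Ω → ℝ) (x : Ω) :
    (kernelOp P)^[n] f x = kernelOp (stepProb P n) f x := by
  induction n generalizing x with
  | zero =>
    simp only [Function.iterate_zero, id, kernelOp, stepProb]
    rw [tsum_eq_single x fun y hy => by rw [if_neg hy.symm, zero_mul]]
    simp
  | succ n ih =>
    rw [Function.iterate_succ_apply', show (kernelOp P)^[n] f = _ from funext ih]
    -- One finite set containing all points reached after `n + 1` steps, so that the sums can be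
    -- interchanged.
    set B := (hP.row x).biUnion (fun z => (hP.isFiniteKernel_stepProb n).row z) with hB
    have h1 : ∀ z ∈ hP.row x,
        kernelOp (stepProb P n) f z = ∑ y ∈ B, stepProb P n z y * f y := fun z hz =>
      tsum_eq_sum fun y hy => by
        rw [(hP.isFiniteKernel_stepProb n).eq_zero_of_notMem_row, zero_mul]
        exact fun h => hy (Finset.mem_biUnion.2 ⟨z, hz, h⟩)
    have h2 : ∀ y, stepProb P (n + 1) x y = ∑ z ∈ hP.row x, P x z * stepProb P n z y := fun y =>
      hP.kernelOp_eq_sum (fun z => stepProb P n z y) x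
    have h3 : kernelOp (stepProb P (n + 1)) f x = ∑ y ∈ B, stepProb P (n + 1) x y * f y :=
      tsum_eq_sum fun y hy => by
        rw [h2, Finset.sum_eq_zero, zero_mul]
        intro z hz
        rw [(hP.isFiniteKernel_stepProb n).eq_zero_of_notMem_row, mul_zero]
        exact fun h => hy (Finset.mem_biUnion.2 ⟨z, hz, h⟩)
    rw [hP.kernelOp_eq_sum, h3, Finset.sum_congr rfl fun z hz => by rw [h1 z hz, Finset.mul_sum],
      Finset.sum_comm]
    refine Finset.sum_congr rfl fun y _ => ?_
    rw [h2, Finset.sum_mul]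
    exact Finset.sum_congr rfl fun z _ => by ring

lemma stepProb_add (hP : IsFiniteKernel P) (m n : ℕ) (x y : Ω) :
    stepProb P (m + n) x y = kernelOp (stepProb P m) (fun z => stepProb P n z y) x := by
  rw [← hP.iterate_eq, stepProb_eq_iterate, ← Function.iterate_add_apply, ← stepProb_eq_iterate]

lemma stepProb_mul_le (hP : IsFiniteKernel P) (m n : ℕ) (x z y : Ω) :
    stepProb P m x z * stepProb P n z y ≤ stepProb P (m + n) x y := by
  rw [hP.stepProb_add]
  exact (hP.isFiniteKernel_stepProb m).mul_le_kernelOp (fun z => hP.stepProb_nonneg n z y) x z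

lemma stepProb_one (P : Ω → Ω → ℝ) : stepProb P 1 = P := by
  classical
  ext x y
  change ∑' z, P x z * (if z = y then 1 else 0) = _
  rw [tsum_eq_single y fun z hz => by rw [if_neg hz, mul_zero]]
  simp

/-- `∑_{n<N} tⁿ Pⁿ (v - t P v) = v - t^N P^N v`. -/
lemma sum_iterate_sub (hP : IsFiniteKernel P) (t : ℝ) (v : Ω → ℝ) (N : ℕ) (x : Ω) :
    ∑ n ∈ Finset.range N, t ^ n * (kernelOp P)^[n] (fun z => v z - t * kernelOp P v z) x =
      v x - t ^ N * (kernelOp P)^[N] v x := by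
  have key : ∀ n x, (kernelOp P)^[n] (fun z => v z - t * kernelOp P v z) x =
      (kernelOp P)^[n] v x - t * (kernelOp P)^[n + 1] v x := by
    intro n
    induction n with
    | zero => intro x; rfl
    | succ n ih =>
      intro x
      rw [Function.iterate_succ_apply', funext ih, hP.kernelOp_sub, hP.kernelOp_smul,
        ← Function.iterate_succ_apply' (f := kernelOp P),
        ← Function.iterate_succ_apply' (f := kernelOp P)]
  induction N with
  | zero => simp
  | succ N ih => rw [Finset.sum_range_succ, ih, key, pow_succ]; ring

/-! ### Green functions and potentials. -/

section Green

variable {t : ℝ}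

lemma green_nonneg (hP : IsFiniteKernel P) (ht : 0 ≤ t) (x y : Ω) : 0 ≤ green P t x y :=
  tsum_nonneg fun n => mul_nonneg (pow_nonneg ht n) (hP.stepProb_nonneg n x y)

open Classical in
lemma green_eq (hP : IsFiniteKernel P)
    (hs : ∀ x y, Summable fun n : ℕ => t ^ n * stepProb P n x y) (x y : Ω) :
    green P t x y = (if x = y then 1 else 0) + t * kernelOp P (fun z => green P t z y) x := by
  have h0 : green P t x y = _ := (hs x y).tsum_eq_zero_add
  rw [h0, hP.kernelOp_eq_sum, Finset.mul_sum]
  congr 1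
  · simp [stepProb]
  · have : ∀ n : ℕ, t ^ (n + 1) * stepProb P (n + 1) x y =
        ∑ z ∈ hP.row x, t * P x z * (t ^ n * stepProb P n z y) := fun n => by
      rw [show stepProb P (n + 1) x y = _ from hP.kernelOp_eq_sum (fun z => stepProb P n z y) x,
        Finset.mul_sum]
      exact Finset.sum_congr rfl fun z _ => by ring
    rw [tsum_congr this, Summable.tsum_finsetSum fun z _ => (hs z y).mul_left _]
    exact Finset.sum_congr rfl fun z _ => by rw [tsum_mul_left, green]; ring

lemma kernelOp_green_of_ne (hP : IsFiniteKernel P)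
    (hs : ∀ x y, Summable fun n : ℕ => t ^ n * stepProb P n x y) {x y : Ω} (hxy : x ≠ y) :
    t * kernelOp P (fun z => green P t z y) x = green P t x y := by
  rw [hP.green_eq hs x y, if_neg hxy, zero_add]

lemma one_le_green_self (hP : IsFiniteKernel P) (ht : 0 ≤ t)
    (hs : ∀ x y, Summable fun n : ℕ => t ^ n * stepProb P n x y) (x : Ω) :
    1 ≤ green P t x x := by
  rw [hP.green_eq hs x x, if_pos rfl]
  exact le_add_of_nonneg_right
    (mul_nonneg ht (hP.kernelOp_nonneg (fun z => hP.green_nonneg ht z x) x))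

/-- Paths that visit `z` at time `k` are among all paths from `x` to `y`. This Harnack-type
inequality later bounds the Martin kernel uniformly in `y`. -/
lemma mul_green_le (hP : IsFiniteKernel P) (ht : 0 ≤ t)
    (hs : ∀ x y, Summable fun n : ℕ => t ^ n * stepProb P n x y) (k : ℕ) (x z y : Ω) :
    t ^ k * stepProb P k x z * green P t z y ≤ green P t x y := by
  rw [green, ← tsum_mul_left]
  refine le_trans (Summable.tsum_le_tsum (g := fun n => t ^ (n + k) * stepProb P (n + k) x y)
    (fun n => ?_) ((hs z y).mul_left _) ((summable_nat_add_iff k).2 (hs x y))) ?_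
  · calc _ = t ^ (n + k) * (stepProb P k x z * stepProb P n z y) := by ring
      _ ≤ _ := mul_le_mul_of_nonneg_left
        (by rw [add_comm n k]; exact hP.stepProb_mul_le k n x z y) (pow_nonneg ht _)
  · rw [green, ← (hs x y).sum_add_tsum_nat_add k]
    exact le_add_of_nonneg_left (Finset.sum_nonneg fun n _ =>
      mul_nonneg (pow_nonneg ht n) (hP.stepProb_nonneg n x y))

/-- Green functions are potentials: `t^N P^N G(·, a) → 0`. -/
lemma tendsto_iterate_green (hP : IsFiniteKernel P)
    (hs : ∀ x y, Summable fun n : ℕ => t ^ n * stepProb P n x y) (x a : Ω) :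
    Tendsto (fun N => t ^ N * (kernelOp P)^[N] (fun z => green P t z a) x) atTop (𝓝 0) := by
  classical
  have h1 := (hs x a).hasSum.tendsto_sum_nat
  have h2 : ∀ N, t ^ N * (kernelOp P)^[N] (fun z => green P t z a) x =
      green P t x a - ∑ n ∈ Finset.range N, t ^ n * stepProb P n x a := fun N => by
    have h3 := hP.sum_iterate_sub t (fun z => green P t z a) N x
    have h4 : (fun z => green P t z a - t * kernelOp P (fun z => green P t z a) z) =
        fun z => if z = a then 1 else 0 := by
      ext z; rw [hP.green_eq hs z a]; ring
    rw [h4] at h3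
    simp only [← stepProb_eq_iterate] at h3
    linarith
  simp only [h2]
  have h5 := h1.const_sub (green P t x a)
  rwa [← green, sub_self] at h5

/-- A function `w ≤ t P w` dominated by a Green potential is non-positive. -/
lemma nonpos_of_le_green (hP : IsFiniteKernel P) (ht : 0 ≤ t)
    (hs : ∀ x y, Summable fun n : ℕ => t ^ n * stepProb P n x y) {w : Ω → ℝ} (C : ℝ) (a : Ω)
    (hw : ∀ x, w x ≤ t * kernelOp P w x) (hwa : ∀ x, w x ≤ C * green P t x a) (x : Ω) :
    w x ≤ 0 := by
  have h1 : ∀ N x, w x ≤ t ^ N * (kernelOp P)^[N] w x := by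
    intro N
    induction N with
    | zero => intro x; simp
    | succ N ih =>
      intro x
      have := mul_le_mul_of_nonneg_left (hP.kernelOp_mono ih x) ht
      rw [hP.kernelOp_smul, ← Function.iterate_succ_apply' (f := kernelOp P)] at this
      calc w x ≤ _ := hw x
        _ ≤ _ := this
        _ = _ := by ring
  have h2 : ∀ N, w x ≤ C * (t ^ N * (kernelOp P)^[N] (fun z => green P t z a) x) := fun N => by
    refine (h1 N x).trans ((mul_le_mul_of_nonneg_left
      (hP.iterate_mono hwa N x) (pow_nonneg ht N)).trans_eq ?_)
    have := congrFun (hP.iterate_sum {a} (fun _ => C) (fun a z => green P t z a) N) x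
    simp only [Finset.sum_singleton] at this
    rw [this]; ring
  have := (hP.tendsto_iterate_green hs x a).const_mul C
  rw [mul_zero] at this
  exact ge_of_tendsto this (Eventually.of_forall h2)

/-- A non-negative harmonic function is approximated by potentials of charges vanishing on a given
finite set. -/
lemma exists_potential_approx (hP : IsFiniteKernel P) (ht : 0 < t)
    (hs : ∀ x y, Summable fun n : ℕ => t ^ n * stepProb P n x y) {h : Ω → ℝ}
    (h0 : ∀ x, 0 ≤ h x) (hh : ∀ x, t * kernelOp P h x = h x) (F : Finset Ω) {ε : ℝ} (hε : 0 < ε) :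
    ∃ (B : Finset Ω) (ν : Ω → ℝ), (∀ y, 0 ≤ ν y) ∧ (∀ y ∈ F, ν y = 0) ∧
      ∀ x ∈ F, |∑ y ∈ B, green P t x y * ν y - h x| ≤ ε := by
  classical
  -- `A` contains `F` and its one-step successors. Since `G(a, a) ≥ 1`, the potential `u` dominates
  -- `h` on `A`; so `v = min(h, u)` agrees with `h` there and its charge `ν` vanishes on `F`.
  set A := F ∪ F.biUnion hP.row with hA
  set u : Ω → ℝ := fun x => ∑ a ∈ A, h a * green P t x a with hu
  set v : Ω → ℝ := fun x => min (h x) (u x) with hv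
  set ν : Ω → ℝ := fun x => v x - t * kernelOp P v x with hν
  have hu0 : ∀ x, 0 ≤ u x := fun x =>
    Finset.sum_nonneg fun a _ => mul_nonneg (h0 a) (hP.green_nonneg ht.le x a)
  have hv0 : ∀ x, 0 ≤ v x := fun x => le_min (h0 x) (hu0 x)
  have huop : ∀ x, t * kernelOp P u x ≤ u x := fun x => by
    rw [hu, hP.kernelOp_sum, Finset.mul_sum]
    refine Finset.sum_le_sum fun a _ => ?_
    rw [hP.kernelOp_smul]
    calc _ = h a * (t * kernelOp P (fun z => green P t z a) x) := by ring
      _ ≤ _ := mul_le_mul_of_nonneg_left ?_ (h0 a)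
    rw [hP.green_eq hs x a]
    exact le_add_of_nonneg_left (by split_ifs <;> norm_num)
  have hν0 : ∀ x, 0 ≤ ν x := fun x => by
    refine sub_nonneg.2 (le_min ?_ ?_)
    · exact (mul_le_mul_of_nonneg_left
        (hP.kernelOp_mono (fun z => min_le_left _ _) x) ht.le).trans_eq (hh x)
    · exact (mul_le_mul_of_nonneg_left
        (hP.kernelOp_mono (fun z => min_le_right _ _) x) ht.le).trans (huop x)
  have hvA : ∀ x ∈ A, v x = h x := fun x hx => by
    refine min_eq_left ?_
    calc h x ≤ h x * green P t x x :=
          le_mul_of_one_le_right (h0 x) (hP.one_le_green_self ht.le hs x)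
      _ ≤ u x := Finset.single_le_sum (f := fun a => h a * green P t x a)
          (fun a _ => mul_nonneg (h0 a) (hP.green_nonneg ht.le x a)) hx
  have hνF : ∀ x ∈ F, ν x = 0 := fun x hx => by
    have h1 : kernelOp P v x = kernelOp P h x := by
      rw [hP.kernelOp_eq_sum, hP.kernelOp_eq_sum]
      refine Finset.sum_congr rfl fun y hy => ?_
      rw [hvA y (Finset.mem_union_right _ (Finset.mem_biUnion.2 ⟨x, hx, hy⟩))]
    rw [hν]
    simp only
    rw [h1, hh, hvA x (Finset.mem_union_left _ hx), sub_self]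
  -- As `v ≤ u` and `u` is a potential, the remainder `t^N P^N v` is small on `F`.
  have hN : ∀ᶠ N in atTop, ∀ x ∈ F, t ^ N * (kernelOp P)^[N] u x < ε := by
    refine (Finset.eventually_all F).2 fun x _ => ?_
    have : Tendsto (fun N => t ^ N * (kernelOp P)^[N] u x) atTop (𝓝 0) := by
      have h1 := tendsto_finsetSum A fun a _ => (hP.tendsto_iterate_green hs x a).const_mul (h a)
      simp only [mul_zero, Finset.sum_const_zero] at h1
      refine h1.congr fun N => ?_
      rw [hu, hP.iterate_sum, Finset.mul_sum]
      exact Finset.sum_congr rfl fun a _ => by ring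
    exact this.eventually_lt_const hε
  obtain ⟨N, hN⟩ := hN.exists
  -- The points reachable from `F` in fewer than `N` steps carry all of the first `N` terms of the
  -- potential of `ν`.
  set B := F.biUnion fun x => (Finset.range N).biUnion fun n =>
    (hP.isFiniteKernel_stepProb n).row x with hB
  refine ⟨B, ν, hν0, hνF, fun x hx => ?_⟩
  have hterm : ∀ M, ∑ y ∈ B, (∑ n ∈ Finset.range M, t ^ n * stepProb P n x y) * ν y =
      ∑ n ∈ Finset.range M, t ^ n * ∑ y ∈ B, stepProb P n x y * ν y := fun M => by
    simp only [Finset.sum_mul, Finset.mul_sum]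
    rw [Finset.sum_comm]
    exact Finset.sum_congr rfl fun n _ => Finset.sum_congr rfl fun y _ => by ring
  have hupper : ∑ y ∈ B, green P t x y * ν y ≤ h x := by
    refine le_of_tendsto (tendsto_finsetSum B fun y _ =>
      ((hs x y).hasSum.tendsto_sum_nat).mul_const (ν y)) (Eventually.of_forall fun M => ?_)
    rw [hterm]
    calc _ ≤ ∑ n ∈ Finset.range M, t ^ n * (kernelOp P)^[n] ν x := by
          refine Finset.sum_le_sum fun n _ => mul_le_mul_of_nonneg_left ?_ (pow_nonneg ht.le n)
          rw [hP.iterate_eq]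
          exact ((hP.isFiniteKernel_stepProb n).summable ν x).sum_le_tsum B
            fun y _ => mul_nonneg (hP.stepProb_nonneg n x y) (hν0 y)
      _ = _ := hP.sum_iterate_sub t v M x
      _ ≤ v x := sub_le_self _ (mul_nonneg (pow_nonneg ht.le M) (hP.iterate_nonneg hv0 M x))
      _ ≤ h x := min_le_left _ _
  have hlower : h x - ε ≤ ∑ y ∈ B, green P t x y * ν y := by
    calc h x - ε ≤ v x - t ^ N * (kernelOp P)^[N] v x := by
          rw [hvA x (Finset.mem_union_left _ hx)]
          refine sub_le_sub_left (le_trans ?_ (hN x hx).le) _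
          exact mul_le_mul_of_nonneg_left
            (hP.iterate_mono (fun z => min_le_right _ _) N x) (pow_nonneg ht.le N)
      _ = ∑ n ∈ Finset.range N, t ^ n * (kernelOp P)^[n] ν x :=
          (hP.sum_iterate_sub t v N x).symm
      _ = ∑ n ∈ Finset.range N, t ^ n * ∑ y ∈ B, stepProb P n x y * ν y := by
          refine Finset.sum_congr rfl fun n hn => ?_
          rw [hP.iterate_eq]
          congr 1
          refine tsum_eq_sum fun y hy => ?_
          rw [(hP.isFiniteKernel_stepProb n).eq_zero_of_notMem_row, zero_mul]
          exact fun hy' => hy (Finset.mem_biUnion.2 ⟨x, hx, Finset.mem_biUnion.2 ⟨n, hn, hy'⟩⟩)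
      _ = _ := (hterm N).symm
      _ ≤ _ := Finset.sum_le_sum fun y _ => mul_le_mul_of_nonneg_right
          ((hs x y).sum_le_tsum _ fun n _ =>
            mul_nonneg (pow_nonneg ht.le n) (hP.stepProb_nonneg n x y)) (hν0 y)
  rw [abs_le]
  constructor <;> linarith

end Green

end IsFiniteKernel

/-! ### Points of the Martin boundary. -/

/-- A point of the Martin boundary has vanishing second coordinate. -/
lemma snd_eq_zero_of_mem_martinBoundary {Ω : Type*} {K : Ω → Ω → ℝ} {ξ : (Ω → ℝ) × (Ω → ℝ)}
    (hξ : ξ ∈ martinBoundary K) : ξ.2 = 0 := by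
  classical
  obtain ⟨hcl, hran⟩ := hξ
  rw [martinCompactification, mem_closure_iff_ultrafilter] at hcl
  obtain ⟨U, hU, hUξ⟩ := hcl
  have h2 : ∀ x, Tendsto (fun p : (Ω → ℝ) × (Ω → ℝ) => p.2 x) U (𝓝 (ξ.2 x)) := fun x =>
    ((continuous_apply x).comp continuous_snd).continuousAt.tendsto.mono_left hUξ
  ext x
  -- Either the ultrafilter is principal at the image of `x`, and then `ξ` would be that image, or
  -- it avoids that image and the indicator at `x` is eventually zero.
  by_cases hx : {martinEmbedding K x} ∈ (U : Filter ((Ω → ℝ) × (Ω → ℝ)))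
  · have h3 : (U : Filter ((Ω → ℝ) × (Ω → ℝ))) ≤ 𝓝 (martinEmbedding K x) :=
      (le_pure_iff.2 hx).trans (pure_le_nhds _)
    exact absurd ⟨x, tendsto_nhds_unique (f := id) h3 hUξ⟩ hran
  · have h3 : ∀ᶠ p in (U : Filter ((Ω → ℝ) × (Ω → ℝ))), (0 : ℝ) = p.2 x := by
      filter_upwards [hU, Ultrafilter.compl_mem_iff_notMem.2 hx] with p hp hpx
      obtain ⟨y, rfl⟩ := hp
      simp only [martinEmbedding]
      rw [if_neg]
      rintro rfl
      exact hpx rfl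
    exact tendsto_nhds_unique (h2 x) (tendsto_const_nhds.congr' h3)

/-- If `h` is a limit of kernels `K(·, y)` with `y` leaving every finite set, then `(h, 0)` is a
point of the Martin boundary. -/
lemma mem_martinBoundary_of_approx {Ω : Type*} {K : Ω → Ω → ℝ} {h : Ω → ℝ}
    (H : ∀ (F : Finset Ω) (ε : ℝ), 0 < ε → ∃ y ∉ F, ∀ x ∈ F, |K x y - h x| < ε) :
    (h, 0) ∈ martinBoundary K := by
  classical
  constructor
  · choose y hyF hy using fun i : Finset Ω × ℕ => H i.1 (1 / (i.2 + 1 : ℝ)) (by positivity)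
    have hmem : ∀ x, ∀ᶠ i : Finset Ω × ℕ in atTop, x ∈ i.1 := fun x => by
      filter_upwards [eventually_ge_atTop (({x} : Finset Ω), 0)] with i hi
      exact hi.1 (Finset.mem_singleton_self x)
    have hε : Tendsto (fun i : Finset Ω × ℕ => 1 / (i.2 + 1 : ℝ)) atTop (𝓝 0) := by
      rw [← prod_atTop_atTop_eq]
      exact tendsto_one_div_add_atTop_nhds_zero_nat.comp tendsto_snd
    refine mem_closure_of_tendsto (f := fun i => martinEmbedding K (y i)) (b := atTop) ?_
      (Eventually.of_forall fun i => ⟨y i, rfl⟩)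
    rw [nhds_prod_eq]
    refine Tendsto.prodMk ?_ ?_
    · refine tendsto_pi_nhds.2 fun x => tendsto_iff_dist_tendsto_zero.2 ?_
      refine squeeze_zero' (Eventually.of_forall fun i => dist_nonneg) ?_ hε
      filter_upwards [hmem x] with i hi
      exact (hy i x hi).le
    · refine tendsto_pi_nhds.2 fun x => ?_
      refine tendsto_const_nhds.congr' ?_
      filter_upwards [hmem x] with i hi
      simp only [Pi.zero_apply]
      rw [if_neg]
      rintro rfl
      exact hyF i hi
  · rintro ⟨y, hy⟩
    have := congrFun (congrArg Prod.snd hy) y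
    simp [martinEmbedding] at this

/-! ### Minimal harmonic functions as Martin limits. -/

namespace IsFiniteKernel

variable {Ω : Type*} {P : Ω → Ω → ℝ}

/-- A minimal harmonic function which is a limit of finite combinations of kernels `K(·, y)` with
`y` leaving every finite set is itself a limit of such kernels. -/
lemma exists_kernel_approx (hP : IsFiniteKernel P) {K : Ω → Ω → ℝ} {s : ℝ} {x₀ : Ω} {h : Ω → ℝ}
    (C : Ω → ℝ) (hK0 : ∀ x y, 0 ≤ K x y) (hKC : ∀ x y, K x y ≤ C x) (hK1 : ∀ y, K x₀ y = 1)
    (hKh : ∀ x y, x ≠ y → kernelOp P (fun z => K z y) x = s * K x y)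
    (hmin : IsMinimalHarmonic P s x₀ h)
    (happ : ∀ (F : Finset Ω) (ε : ℝ), 0 < ε → ∃ (B : Finset Ω) (w : Ω → ℝ), (∀ y, 0 ≤ w y) ∧
      (∀ y ∈ F, w y = 0) ∧ ∀ x ∈ F, |∑ y ∈ B, w y * K x y - h x| ≤ ε)
    (F : Finset Ω) (ε : ℝ) (hε : 0 < ε) : ∃ y ∉ F, ∀ x ∈ F, |K x y - h x| < ε := by
  classical
  choose B w hw0 hwF hw using fun i : Finset Ω × ℕ => happ i.1 (1 / (i.2 + 1 : ℝ)) (by positivity)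
  obtain ⟨U, hU⟩ : ∃ U : Ultrafilter (Finset Ω × ℕ), (U : Filter (Finset Ω × ℕ)) ≤ atTop :=
    Ultrafilter.exists_le atTop
  have hmem : ∀ x, ∀ᶠ i : Finset Ω × ℕ in U, x ∈ i.1 := fun x => by
    refine hU ?_
    filter_upwards [eventually_ge_atTop (({x} : Finset Ω), 0)] with i hi
    exact hi.1 (Finset.mem_singleton_self x)
  have hε0 : Tendsto (fun i : Finset Ω × ℕ => 1 / (i.2 + 1 : ℝ)) U (𝓝 0) := by
    refine Tendsto.mono_left ?_ hU
    rw [← prod_atTop_atTop_eq]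
    exact tendsto_one_div_add_atTop_nhds_zero_nat.comp tendsto_snd
  have hlim : ∀ x, Tendsto (fun i => ∑ y ∈ B i, w i y * K x y) U (𝓝 (h x)) := fun x => by
    refine tendsto_iff_dist_tendsto_zero.2
      (squeeze_zero' (Eventually.of_forall fun i => dist_nonneg) ?_ hε0)
    filter_upwards [hmem x] with i hi
    exact hw i x hi
  -- Weighting the kernels by a bounded `φ` produces in the limit a multiple of `h`.
  have key : ∀ (φ : Ω → ℝ) (M : ℝ), (∀ y, 0 ≤ φ y) → (∀ y, φ y ≤ M) → 0 < M →
      ∃ c : ℝ, ∀ x, Tendsto (fun i => ∑ y ∈ B i, w i y * φ y * K x y) U (𝓝 (c * h x)) := by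
    intro φ M hφ0 hφM hM
    have hle : ∀ x i, ∑ y ∈ B i, w i y * φ y * K x y ≤ M * ∑ y ∈ B i, w i y * K x y := by
      intro x i
      rw [Finset.mul_sum]
      refine Finset.sum_le_sum fun y _ => ?_
      calc _ = φ y * (w i y * K x y) := by ring
        _ ≤ _ := mul_le_mul_of_nonneg_right (hφM y) (mul_nonneg (hw0 i y) (hK0 x y))
    have hnn : ∀ x i, 0 ≤ ∑ y ∈ B i, w i y * φ y * K x y := fun x i =>
      Finset.sum_nonneg fun y _ => mul_nonneg (mul_nonneg (hw0 i y) (hφ0 y)) (hK0 x y)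
    have hex : ∀ x, ∃ a, Tendsto (fun i => ∑ y ∈ B i, w i y * φ y * K x y) U (𝓝 a) := fun x => by
      have hev : ∀ᶠ i in (U : Filter (Finset Ω × ℕ)),
          ∑ y ∈ B i, w i y * φ y * K x y ∈ Set.Icc 0 (M * (h x + 1)) := by
        filter_upwards [(hlim x).eventually_lt_const (lt_add_one (h x))] with i hi
        exact ⟨hnn x i, (hle x i).trans (mul_le_mul_of_nonneg_left hi.le hM.le)⟩
      obtain ⟨a, -, ha⟩ := (isCompact_Icc (a := (0 : ℝ)) (b := M * (h x + 1))).ultrafilter_le_nhds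
        (U.map fun i => ∑ y ∈ B i, w i y * φ y * K x y) (le_principal_iff.2 hev)
      exact ⟨a, ha⟩
    choose g hg using hex
    obtain ⟨c, -, hc⟩ := hmin.minimal g
      (fun x => ge_of_tendsto (hg x) (Eventually.of_forall (hnn x)))
      (fun x => by
        change kernelOp P g x = _
        rw [hP.kernelOp_eq_sum]
        refine tendsto_nhds_unique (tendsto_finsetSum _ fun z _ => (hg z).const_mul (P x z))
          (((hg x).const_mul s).congr' ?_)
        filter_upwards [hmem x] with i hi
        have h1 : ∀ y ∈ B i, s * (w i y * φ y * K x y) =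
            ∑ z ∈ hP.row x, P x z * (w i y * φ y * K z y) := fun y _ => by
          -- `K(·, y)` fails to be harmonic only at `y`, and the weight of `y = x` is zero once `x`
          -- lies in the finite set.
          by_cases hxy : x = y
          · subst hxy
            simp [hwF i x hi]
          · rw [mul_left_comm, ← hKh x y hxy, hP.kernelOp_eq_sum, Finset.mul_sum]
            exact Finset.sum_congr rfl fun z _ => by ring
        rw [Finset.mul_sum, Finset.sum_congr rfl h1, Finset.sum_comm]
        exact Finset.sum_congr rfl fun z _ => by rw [Finset.mul_sum])
      ⟨M, hM, fun x => le_of_tendsto_of_tendsto (hg x) ((hlim x).const_mul M)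
        (Eventually.of_forall (hle x))⟩
    exact ⟨c, fun x => hc x ▸ hg x⟩
  have hone : Tendsto (fun i => ∑ y ∈ B i, w i y) U (𝓝 1) := by
    have := hlim x₀
    simp only [hK1, mul_one, hmin.normalized] at this
    exact this
  -- Take `φ = K(x, ·)`. Evaluating at `x₀` identifies the constant as `c = h x`, so the second
  -- moment of `K(x, ·)` tends to `h(x)²` and the variance tends to zero.
  have hvar : ∀ x, Tendsto (fun i => ∑ y ∈ B i, w i y * (K x y - h x) ^ 2) U (𝓝 0) := fun x => by
    obtain ⟨c, hc⟩ := key (K x) (|C x| + 1) (hK0 x)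
      (fun y => (hKC x y).trans ((le_abs_self _).trans (le_add_of_nonneg_right zero_le_one)))
      (by positivity)
    have hc0 := hc x₀
    simp only [hK1, mul_one, hmin.normalized] at hc0
    obtain rfl := tendsto_nhds_unique hc0 (hlim x)
    have := ((hc x).sub ((hlim x).const_mul (2 * h x))).add (hone.const_mul (h x ^ 2))
    rw [show h x * h x - 2 * h x * h x + h x ^ 2 * 1 = 0 by ring] at this
    refine this.congr fun i => ?_
    rw [Finset.mul_sum, Finset.mul_sum, ← Finset.sum_sub_distrib, ← Finset.sum_add_distrib]
    exact Finset.sum_congr rfl fun y _ => by ring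
  -- If every `y ∉ F` fails at some `x ∈ F`, the variances summed over `F` are at least `ε²` times a
  -- total mass tending to `1`.
  by_contra! hcon
  have hsum := tendsto_finsetSum F fun x _ => hvar x
  rw [Finset.sum_const_zero] at hsum
  have hge : ∀ᶠ i in (U : Filter (Finset Ω × ℕ)), ε ^ 2 * ∑ y ∈ B i, w i y ≤
      ∑ x ∈ F, ∑ y ∈ B i, w i y * (K x y - h x) ^ 2 := by
    filter_upwards [(Finset.eventually_all F).2 fun x _ => hmem x] with i hi
    rw [Finset.mul_sum, Finset.sum_comm]
    refine Finset.sum_le_sum fun y _ => ?_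
    by_cases hy : y ∈ F
    · simp [hwF i y (hi y hy)]
    · obtain ⟨x, hx, hxε⟩ := hcon y hy
      rw [mul_comm]
      calc w i y * ε ^ 2 ≤ w i y * (K x y - h x) ^ 2 :=
            mul_le_mul_of_nonneg_left (by
              rw [← sq_abs (K x y - h x)]; exact pow_le_pow_left₀ hε.le hxε 2) (hw0 i y)
        _ ≤ _ := Finset.single_le_sum (f := fun x => w i y * (K x y - h x) ^ 2)
          (fun x _ => mul_nonneg (hw0 i y) (sq_nonneg _)) hx
  have := le_of_tendsto_of_tendsto (hone.const_mul (ε ^ 2)) hsum hge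
  have : 0 < ε ^ 2 := by positivity
  linarith

/-- Minimal harmonic functions of a transient kernel are represented by Martin boundary points. -/
theorem mem_martinBoundary_of_isMinimalHarmonic (hP : IsFiniteKernel P) {t : ℝ} (ht : 0 < t)
    (hs : ∀ x y, Summable fun n : ℕ => t ^ n * stepProb P n x y) {x₀ : Ω}
    (hreach : ∀ x, ∃ k, 0 < stepProb P k x₀ x) {h : Ω → ℝ}
    (hmin : IsMinimalHarmonic P t⁻¹ x₀ h) : (h, 0) ∈ martinBoundary (greenRatio P x₀ t) := by
  choose k hk using hreach
  have hc : ∀ x, 0 < t ^ k x * stepProb P (k x) x₀ x := fun x =>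
    mul_pos (pow_pos ht _) (hk x)
  have hG0 : ∀ y, 0 < green P t x₀ y := fun y =>
    (hc y).trans_le <| (le_mul_of_one_le_right (hc y).le (hP.one_le_green_self ht.le hs y)).trans
      (hP.mul_green_le ht.le hs (k y) x₀ y y)
  -- The constant bounding `K(x, ·)` comes from `mul_green_le` along a path from `x₀` to `x`.
  refine mem_martinBoundary_of_approx (hP.exists_kernel_approx
    (fun x => (t ^ k x * stepProb P (k x) x₀ x)⁻¹)
    (fun x y => div_nonneg (hP.green_nonneg ht.le x y) (hG0 y).le) (fun x y => ?_)
    (fun y => div_self (hG0 y).ne') (fun x y hxy => ?_) hmin fun F ε hε => ?_)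
  · rw [greenRatio, div_le_iff₀ (hG0 y), ← div_eq_inv_mul, le_div_iff₀ (hc x), mul_comm]
    exact hP.mul_green_le ht.le hs (k x) x₀ x y
  · have h1 : (fun z => greenRatio P x₀ t z y) =
        fun z => (green P t x₀ y)⁻¹ * green P t z y := by
      ext z; rw [greenRatio, div_eq_inv_mul]
    rw [h1, hP.kernelOp_smul, greenRatio, ← hP.kernelOp_green_of_ne hs hxy]
    field_simp
  · obtain ⟨B, ν, hν0, hνF, hν⟩ := hP.exists_potential_approx ht hs hmin.nonneg
      (fun x => by
        rw [show kernelOp P h x = _ from hmin.harmonic x, mul_inv_cancel_left₀ ht.ne']) F hε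
    -- Normalising `G(·, y)` to `K(·, y)` moves the factor `G(x₀, y)` into the charge.
    refine ⟨B, fun y => green P t x₀ y * ν y, fun y => mul_nonneg (hG0 y).le (hν0 y),
      fun y hy => by simp only [hνF y hy, mul_zero], fun x hx => ?_⟩
    convert hν x hx using 4 with y _
    rw [greenRatio]
    field_simp [(hG0 y).ne']

end IsFiniteKernel

/-! ### The random walk and its word norm. -/

/-- The assumptions on the law of the random walk: a finitely supported probability measure whose
support generates the group as a semigroup and contains the identity. -/
structure IsLazyAdmissible {Γ : Type*} [Group Γ] (μ : Γ → ℝ) : Prop where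
  nonneg : ∀ x, 0 ≤ μ x
  hasSum : HasSum μ 1
  finite : (Function.support μ).Finite
  admissible : Subsemigroup.closure (Function.support μ) = ⊤
  lazy : 0 < μ 1

namespace IsLazyAdmissible

variable {Γ : Type*} [Group Γ] {μ : Γ → ℝ}

lemma isFiniteKernel (hμ : IsLazyAdmissible μ) : IsFiniteKernel (walkKernel μ) where
  nonneg _ _ := hμ.nonneg _
  finite x := hμ.finite.preimage (mul_right_injective x⁻¹).injOn

lemma isFiniteKernel_trunc (hμ : IsLazyAdmissible μ) : IsFiniteKernel (truncKernel μ) where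
  nonneg x y := by unfold truncKernel; split_ifs; exacts [hμ.nonneg _, le_rfl]
  finite x := (hμ.isFiniteKernel.finite x).subset fun y hy => by
    simp only [truncKernel, Function.mem_support, ne_eq, ite_eq_right_iff, Classical.not_imp] at hy
    exact hy.2

lemma stepProb_mul_left (g : Γ) (n : ℕ) (x y : Γ) :
    stepProb (walkKernel μ) n (g * x) (g * y) = stepProb (walkKernel μ) n x y := by
  induction n generalizing x with
  | zero => simp only [stepProb]; by_cases h : x = y <;> simp [h]
  | succ n ih =>
    change ∑' z, _ = ∑' z, _
    rw [← (Equiv.mulLeft g).tsum_eq]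
    refine tsum_congr fun z => ?_
    rw [Equiv.coe_mulLeft, ih]
    congr 1
    simp [walkKernel, mul_assoc]

lemma stepProb_self (n : ℕ) (x : Γ) :
    stepProb (walkKernel μ) n x x = stepProb (walkKernel μ) n 1 1 := by
  simpa using stepProb_mul_left (μ := μ) x n 1 1

lemma green_self (r : ℝ) (x : Γ) : green (walkKernel μ) r x x = green (walkKernel μ) r 1 1 :=
  tsum_congr fun n => by rw [stepProb_self]

lemma stepProb_le_one (hμ : IsLazyAdmissible μ) (n : ℕ) (x y : Γ) :
    stepProb (walkKernel μ) n x y ≤ 1 := by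
  classical
  rw [show stepProb (walkKernel μ) n x y = _ from
    congrFun (IsFiniteKernel.stepProb_eq_iterate _ n y) x]
  refine (hμ.isFiniteKernel.iterate_mono (g := fun _ => 1)
    (fun x => by split_ifs <;> norm_num) n x).trans_eq ?_
  have h1 : kernelOp (walkKernel μ) (fun _ => 1) = fun _ => 1 := by
    ext x
    simp only [kernelOp, mul_one, walkKernel]
    exact ((Equiv.mulLeft x⁻¹).tsum_eq μ).trans hμ.hasSum.tsum_eq
  exact congrFun (Function.iterate_fixed h1 n) x

lemma stepProb_one_apply (x y : Γ) : stepProb (walkKernel μ) 1 x y = μ (x⁻¹ * y) :=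
  congrFun (congrFun (IsFiniteKernel.stepProb_one _) x) y

lemma stepProb_succ_pos (hμ : IsLazyAdmissible μ) {n : ℕ} {x z y : Γ}
    (h : 0 < stepProb (walkKernel μ) n x z) (h' : 0 < μ (z⁻¹ * y)) :
    0 < stepProb (walkKernel μ) (n + 1) x y :=
  (mul_pos h (by rwa [stepProb_one_apply])).trans_le (hμ.isFiniteKernel.stepProb_mul_le n 1 x z y)

lemma pow_le_stepProb (hμ : IsLazyAdmissible μ) (n : ℕ) :
    μ 1 ^ n ≤ stepProb (walkKernel μ) n 1 1 := by
  induction n with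
  | zero => simp [stepProb]
  | succ n ih =>
    refine le_trans ?_ (hμ.isFiniteKernel.stepProb_mul_le n 1 1 1 1)
    rw [stepProb_one_apply, pow_succ, inv_one, one_mul]
    exact mul_le_mul_of_nonneg_right ih hμ.lazy.le

lemma exists_pred (hμ : IsLazyAdmissible μ) {n : ℕ} {x : Γ}
    (h : 0 < stepProb (walkKernel μ) (n + 1) 1 x) :
    ∃ z, 0 < stepProb (walkKernel μ) n 1 z ∧ 0 < μ (z⁻¹ * x) := by
  by_contra! hcon
  rw [hμ.isFiniteKernel.stepProb_add] at h
  refine h.not_ge (tsum_nonpos fun z => ?_)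
  beta_reduce
  rw [stepProb_one_apply]
  rcases (hμ.isFiniteKernel.stepProb_nonneg n 1 z).eq_or_lt with h0 | h0
  · rw [← h0, zero_mul]
  · exact mul_nonpos_of_nonneg_of_nonpos h0.le (hcon z h0)

lemma exists_stepProb_pos (hμ : IsLazyAdmissible μ) (x y : Γ) :
    ∃ n, 0 < stepProb (walkKernel μ) n x y := by
  have h1 : ∀ x, ∃ n, 0 < stepProb (walkKernel μ) n 1 x := fun x => by
    have hx : x ∈ Subsemigroup.closure (Function.support μ) := hμ.admissible ▸ Subsemigroup.mem_top x
    induction hx using Subsemigroup.closure_induction with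
    | mem x hx =>
      exact ⟨1, by rw [stepProb_one_apply, inv_one, one_mul]; exact (hμ.nonneg x).lt_of_ne' hx⟩
    | mul x y _ _ ihx ihy =>
      obtain ⟨m, hm⟩ := ihx
      obtain ⟨n, hn⟩ := ihy
      refine ⟨m + n, (mul_pos hm ?_).trans_le
        (hμ.isFiniteKernel.stepProb_mul_le m n 1 x (x * y))⟩
      have := stepProb_mul_left (μ := μ) x n 1 y
      rw [mul_one] at this
      rwa [this]
  obtain ⟨n, hn⟩ := h1 (x⁻¹ * y)
  refine ⟨n, ?_⟩
  have := stepProb_mul_left (μ := μ) x n 1 (x⁻¹ * y)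
  rw [mul_one, mul_inv_cancel_left] at this
  rwa [this]

lemma stepProb_wordNorm_pos (hμ : IsLazyAdmissible μ) (x : Γ) :
    0 < stepProb (walkKernel μ) (wordNorm μ x) 1 x :=
  Nat.sInf_mem (s := {n | 0 < stepProb (walkKernel μ) n 1 x}) (hμ.exists_stepProb_pos 1 x)

lemma wordNorm_le {n : ℕ} {x : Γ} (h : 0 < stepProb (walkKernel μ) n 1 x) : wordNorm μ x ≤ n :=
  Nat.sInf_le h

/-- By laziness the walk may wait at `x` once it has arrived, so no parity obstruction occurs. -/
lemma stepProb_pos_iff (hμ : IsLazyAdmissible μ) {n : ℕ} {x : Γ} :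
    0 < stepProb (walkKernel μ) n 1 x ↔ wordNorm μ x ≤ n := by
  refine ⟨wordNorm_le, fun h => ?_⟩
  induction n, h using Nat.le_induction with
  | base => exact hμ.stepProb_wordNorm_pos x
  | succ n _ ih => exact hμ.stepProb_succ_pos ih (by rw [inv_mul_cancel]; exact hμ.lazy)

lemma wordNorm_one : wordNorm μ (1 : Γ) = 0 :=
  Nat.le_zero.1 (wordNorm_le (by simp [stepProb]))

/-- One more step extends a shortest path. This is what keeps the natural-number exponent `|x| + 1 -
|y|` from being truncated wherever `μ(x⁻¹y) ≠ 0`. -/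
lemma wordNorm_le_succ (hμ : IsLazyAdmissible μ) {x y : Γ} (h : μ (x⁻¹ * y) ≠ 0) :
    wordNorm μ y ≤ wordNorm μ x + 1 :=
  wordNorm_le (hμ.stepProb_succ_pos (hμ.stepProb_wordNorm_pos x) ((hμ.nonneg _).lt_of_ne' h))

/-! ### The Green function up to the radius of convergence -/

/-- Completing a path from `x` to `y` by a fixed path from `y` back to `x` compares the series with
the diagonal one. -/
lemma summable_green (hμ : IsLazyAdmissible μ) {r : ℝ} (hr : 0 < r)
    (hs : Summable fun n : ℕ => r ^ n * stepProb (walkKernel μ) n 1 1) (x y : Γ) :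
    Summable fun n : ℕ => r ^ n * stepProb (walkKernel μ) n x y := by
  obtain ⟨k, hk⟩ := hμ.exists_stepProb_pos y x
  refine Summable.of_nonneg_of_le
    (fun n => mul_nonneg (pow_nonneg hr.le n) (hμ.isFiniteKernel.stepProb_nonneg n x y))
    (fun n => ?_) (((summable_nat_add_iff k).2 hs).mul_left
      (r ^ k * stepProb (walkKernel μ) k y x)⁻¹)
  rw [← div_eq_inv_mul, le_div_iff₀ (mul_pos (pow_pos hr k) hk)]
  calc _ = r ^ (n + k) * (stepProb (walkKernel μ) n x y * stepProb (walkKernel μ) k y x) := by ring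
    _ ≤ _ := mul_le_mul_of_nonneg_left (by
      rw [← stepProb_self (n + k) x]; exact hμ.isFiniteKernel.stepProb_mul_le n k x y x)
      (pow_nonneg hr.le _)

lemma root_nonneg (hμ : IsLazyAdmissible μ) (n : ℕ) :
    0 ≤ stepProb (walkKernel μ) n 1 1 ^ (1 / (n : ℝ)) :=
  Real.rpow_nonneg (hμ.isFiniteKernel.stepProb_nonneg n 1 1) _

lemma isBoundedUnder_root (hμ : IsLazyAdmissible μ) :
    IsBoundedUnder (· ≤ ·) atTop
      fun n : ℕ => stepProb (walkKernel μ) n 1 1 ^ (1 / (n : ℝ)) :=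
  isBoundedUnder_of ⟨1, fun n => Real.rpow_le_one (hμ.isFiniteKernel.stepProb_nonneg n 1 1)
    (hμ.stepProb_le_one n 1 1) (by positivity)⟩

lemma isCoboundedUnder_root (hμ : IsLazyAdmissible μ) :
    IsCoboundedUnder (· ≤ ·) atTop
      fun n : ℕ => stepProb (walkKernel μ) n 1 1 ^ (1 / (n : ℝ)) :=
  (isBoundedUnder_of (r := (· ≥ ·)) ⟨0, hμ.root_nonneg⟩).isCoboundedUnder_le

lemma spectralRad_pos (hμ : IsLazyAdmissible μ) : 0 < spectralRad μ := by
  refine hμ.lazy.trans_le (le_limsup_of_frequently_le (Eventually.frequently ?_)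
    hμ.isBoundedUnder_root)
  filter_upwards [eventually_ge_atTop 1] with n hn
  calc μ 1 = (μ 1 ^ n) ^ (1 / (n : ℝ)) := by
        rw [one_div, Real.pow_rpow_inv_natCast hμ.lazy.le (by omega)]
    _ ≤ _ := Real.rpow_le_rpow (pow_nonneg hμ.lazy.le n) (hμ.pow_le_stepProb n) (by positivity)

lemma convRadius_pos (hμ : IsLazyAdmissible μ) : 0 < convRadius μ :=
  inv_pos.2 hμ.spectralRad_pos

/-- The root test, with `q` strictly between `ρ` and `r⁻¹`. -/
lemma summable_of_lt_convRadius (hμ : IsLazyAdmissible μ) {r : ℝ} (hr : 0 < r)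
    (hrR : r < convRadius μ) :
    Summable fun n : ℕ => r ^ n * stepProb (walkKernel μ) n 1 1 := by
  have h1 : spectralRad μ < r⁻¹ := (lt_inv_comm₀ hr hμ.spectralRad_pos).1 hrR
  obtain ⟨q, hq, hqr⟩ := exists_between h1
  have hq0 : 0 < q := hμ.spectralRad_pos.trans hq
  have hev := eventually_lt_of_limsup_lt hq hμ.isBoundedUnder_root
  refine Summable.of_norm_bounded_eventually_nat (g := fun n => (r * q) ^ n)
    (summable_geometric_of_lt_one (mul_pos hr hq0).le ?_) ?_
  · calc r * q < r * r⁻¹ := mul_lt_mul_of_pos_left hqr hr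
      _ = 1 := mul_inv_cancel₀ hr.ne'
  · filter_upwards [hev, eventually_ge_atTop 1] with n hn hn1
    have h0 := hμ.isFiniteKernel.stepProb_nonneg n 1 1
    rw [Real.norm_of_nonneg (mul_nonneg (pow_nonneg hr.le n) h0), mul_pow]
    refine mul_le_mul_of_nonneg_left ?_ (pow_nonneg hr.le n)
    calc stepProb (walkKernel μ) n 1 1
        = (stepProb (walkKernel μ) n 1 1 ^ (1 / (n : ℝ))) ^ n := by
          rw [one_div, Real.rpow_inv_natCast_pow h0 (by omega)]
      _ ≤ q ^ n := pow_le_pow_left₀ (hμ.root_nonneg n) hn.le n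

lemma iterate_of_harmonic (hμ : IsLazyAdmissible μ) {s : ℝ} {h : Γ → ℝ}
    (hh : IsHarmonic (walkKernel μ) s h) (n : ℕ) (x : Γ) :
    (kernelOp (walkKernel μ))^[n] h x = s ^ n * h x := by
  induction n generalizing x with
  | zero => simp
  | succ n ih =>
    rw [Function.iterate_succ_apply', funext ih, hμ.isFiniteKernel.kernelOp_smul]
    beta_reduce
    rw [show kernelOp (walkKernel μ) h x = _ from hh x]
    ring

lemma stepProb_mul_le_of_harmonic (hμ : IsLazyAdmissible μ) {s : ℝ} {h : Γ → ℝ}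
    (h0 : ∀ x, 0 ≤ h x) (hh : IsHarmonic (walkKernel μ) s h) (n : ℕ) (x y : Γ) :
    stepProb (walkKernel μ) n x y * h y ≤ s ^ n * h x := by
  rw [← hμ.iterate_of_harmonic hh, hμ.isFiniteKernel.iterate_eq]
  exact (hμ.isFiniteKernel.isFiniteKernel_stepProb n).mul_le_kernelOp h0 x y

/-- Iterating harmonicity and keeping one term gives `Pⁿ(e, e) ≤ r⁻ⁿ`. This confines the parameter
of the union to `[0, R]`. -/
lemma le_convRadius (hμ : IsLazyAdmissible μ) {r : ℝ} (hr : 0 < r) {h : Γ → ℝ}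
    (h0 : ∀ x, 0 ≤ h x) (h1 : h 1 = 1) (hh : IsHarmonic (walkKernel μ) r⁻¹ h) :
    r ≤ convRadius μ := by
  rw [convRadius, le_inv_comm₀ hr hμ.spectralRad_pos]
  refine limsup_le_of_le hμ.isCoboundedUnder_root ?_
  filter_upwards [eventually_ge_atTop 1] with n hn
  have := hμ.stepProb_mul_le_of_harmonic h0 hh n 1 1
  rw [h1, mul_one, mul_one] at this
  calc _ ≤ (r⁻¹ ^ n) ^ (1 / (n : ℝ)) :=
        Real.rpow_le_rpow (hμ.isFiniteKernel.stepProb_nonneg n 1 1) this (by positivity)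
    _ = r⁻¹ := by rw [one_div, Real.pow_rpow_inv_natCast (inv_pos.2 hr).le (by omega)]

lemma pos_of_harmonic (hμ : IsLazyAdmissible μ) {s : ℝ} (hs : 0 < s) {h : Γ → ℝ}
    (h0 : ∀ x, 0 ≤ h x) (h1 : h 1 = 1) (hh : IsHarmonic (walkKernel μ) s h) (x : Γ) :
    0 < h x := by
  obtain ⟨n, hn⟩ := hμ.exists_stepProb_pos x 1
  have := hμ.stepProb_mul_le_of_harmonic h0 hh n x 1
  rw [h1, mul_one] at this
  exact pos_of_mul_pos_right (hn.trans_le this) (pow_nonneg hs.le n)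

lemma green_pos (hμ : IsLazyAdmissible μ) {r : ℝ} (hr : 0 < r)
    (hs : Summable fun n : ℕ => r ^ n * stepProb (walkKernel μ) n 1 1) (x y : Γ) :
    0 < green (walkKernel μ) r x y := by
  obtain ⟨n, hn⟩ := hμ.exists_stepProb_pos x y
  exact (hμ.summable_green hr hs x y).tsum_pos
    (fun n => mul_nonneg (pow_nonneg hr.le n) (hμ.isFiniteKernel.stepProb_nonneg n x y)) n
    (mul_pos (pow_pos hr n) hn)

/-- The domination principle: `G(x, y | s) h(y) ≤ G(y, y | s) h(x)` for positive harmonic `h`. -/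
lemma green_mul_le_of_harmonic (hμ : IsLazyAdmissible μ) {s r : ℝ} (hs : 0 < s) (hsr : s ≤ r)
    (hsum : Summable fun n : ℕ => s ^ n * stepProb (walkKernel μ) n 1 1) {h : Γ → ℝ}
    (h0 : ∀ x, 0 ≤ h x) (hh : IsHarmonic (walkKernel μ) r⁻¹ h) (x y : Γ) :
    h y * green (walkKernel μ) s x y ≤ green (walkKernel μ) s y y * h x := by
  have hP := hμ.isFiniteKernel
  have hS := hμ.summable_green hs hsum
  set G := fun z => green (walkKernel μ) s z y with hG
  have hG0 : ∀ z, 0 ≤ G z := fun z => hP.green_nonneg hs.le z y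
  have hsup : ∀ z, s * kernelOp (walkKernel μ) h z ≤ h z := fun z => by
    rw [show kernelOp (walkKernel μ) h z = _ from hh z, ← mul_assoc, ← div_eq_mul_inv]
    exact mul_le_of_le_one_left (h0 z) ((div_le_one (hs.trans_le hsr)).2 hsr)
  -- The positive part of `h(y) G(·, y) - G(y, y) h` vanishes at `y`, is subharmonic and lies below
  -- the potential `h(y) G(·, y)`, so it is zero.
  have hw := hP.nonpos_of_le_green hs.le hS (w := fun z => max (h y * G z - G y * h z) 0) (h y) y
    (fun z => by
      have hop : 0 ≤ s * kernelOp (walkKernel μ) (fun z => max (h y * G z - G y * h z) 0) z :=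
        mul_nonneg hs.le (hP.kernelOp_nonneg (fun z => le_max_right _ _) z)
      refine max_le ?_ hop
      by_cases hzy : z = y
      · rw [hzy, mul_comm, sub_self]; exact hzy ▸ hop
      · calc h y * G z - G y * h z
            ≤ h y * (s * kernelOp (walkKernel μ) G z) -
              G y * (s * kernelOp (walkKernel μ) h z) :=
              sub_le_sub (by rw [hG, hP.kernelOp_green_of_ne hS hzy])
                (mul_le_mul_of_nonneg_left (hsup z) (hG0 y))
          _ = s * kernelOp (walkKernel μ) (fun z => h y * G z - G y * h z) z := by
              rw [hP.kernelOp_sub, hP.kernelOp_smul, hP.kernelOp_smul]; ring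
          _ ≤ _ := mul_le_mul_of_nonneg_left (hP.kernelOp_mono (fun z => le_max_left _ _) z) hs.le)
    (fun z => max_le (sub_le_self _ (mul_nonneg (hG0 y) (h0 z))) (mul_nonneg (h0 y) (hG0 z))) x
  exact sub_nonpos.1 ((le_max_left _ _).trans hw)

lemma tendsto_green_atTop (hμ : IsLazyAdmissible μ)
    (hrec : ¬ Summable fun n : ℕ => convRadius μ ^ n * stepProb (walkKernel μ) n 1 1) :
    Tendsto (fun s => green (walkKernel μ) s 1 1) (𝓝[<] convRadius μ) atTop := by
  have hR := hμ.convRadius_pos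
  rw [not_summable_iff_tendsto_nat_atTop_of_nonneg fun n =>
    mul_nonneg (pow_nonneg hR.le n) (hμ.isFiniteKernel.stepProb_nonneg n 1 1)] at hrec
  refine tendsto_atTop.2 fun M => ?_
  obtain ⟨N, hN⟩ := (hrec.eventually_gt_atTop M).exists
  have hcont : Continuous fun s : ℝ =>
      ∑ n ∈ Finset.range N, s ^ n * stepProb (walkKernel μ) n 1 1 := by fun_prop
  filter_upwards [(hcont.tendsto _).mono_left nhdsWithin_le_nhds |>.eventually_const_lt hN,
    (eventually_gt_nhds hR).filter_mono nhdsWithin_le_nhds, self_mem_nhdsWithin] with s hs hs0 hsR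
  exact hs.le.trans ((hμ.summable_of_lt_convRadius hs0 hsR).sum_le_tsum _ fun n _ =>
    mul_nonneg (pow_nonneg hs0.le n) (hμ.isFiniteKernel.stepProb_nonneg n 1 1))

/-- In the `R`-recurrent case, the first passage generating functions at `R` are the quotients of
the positive harmonic function. -/
lemma tendsto_green_div_of_recurrent (hμ : IsLazyAdmissible μ)
    (hrec : ¬ Summable fun n : ℕ => convRadius μ ^ n * stepProb (walkKernel μ) n 1 1) {h : Γ → ℝ}
    (h0 : ∀ x, 0 ≤ h x) (h1 : h 1 = 1) (hh : IsHarmonic (walkKernel μ) (convRadius μ)⁻¹ h)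
    (x y : Γ) :
    Tendsto (fun s => green (walkKernel μ) s x y / green (walkKernel μ) s 1 1)
      (𝓝[<] convRadius μ) (𝓝 (h x / h y)) := by
  classical
  have hP := hμ.isFiniteKernel
  have hR := hμ.convRadius_pos
  have hy := hμ.pos_of_harmonic (inv_pos.2 hR) h0 h1 hh y
  obtain ⟨n, hn⟩ := hμ.exists_stepProb_pos y x
  set R := convRadius μ with hRdef
  -- `D` and `c` are independent of `s`. The bound `w x ≤ D / c` is therefore uniform, while the
  -- normalising `G(e, e | s)` tends to infinity; `R / 2` serves as a lower bound for `s` near `R`.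
  set D := h y * ∑ k ∈ Finset.range n, R ^ k with hD
  have hD0 : 0 ≤ D := mul_nonneg hy.le (Finset.sum_nonneg fun k _ => pow_nonneg hR.le k)
  set c := (R / 2) ^ n * stepProb (walkKernel μ) n y x with hc
  have hc0 : 0 < c := mul_pos (pow_pos (half_pos hR) n) hn
  have hev : ∀ᶠ s in 𝓝[<] R, |h x / h y - green (walkKernel μ) s x y / green (walkKernel μ) s 1 1| ≤
      D / c / h y / green (walkKernel μ) s 1 1 := by
    filter_upwards [(eventually_gt_nhds (half_lt_self hR)).filter_mono nhdsWithin_le_nhds,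
      self_mem_nhdsWithin] with s hs hsR
    have hs0 : 0 < s := (half_pos hR).trans hs
    have hsum := hμ.summable_of_lt_convRadius hs0 hsR
    have hS := hμ.summable_green hs0 hsum
    have hG := hμ.green_pos hs0 hsum 1 1
    set w : Γ → ℝ := fun z =>
      green (walkKernel μ) s 1 1 * h z - h y * green (walkKernel μ) s z y with hw
    have hw0 : ∀ z, 0 ≤ w z := fun z => sub_nonneg.2
      (green_self (μ := μ) s y ▸ hμ.green_mul_le_of_harmonic hs0 (le_of_lt hsR) hsum h0 hh z y)
    have hwy : w y = 0 := by simp only [hw]; rw [green_self s y]; ring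
    -- The function `w` is superharmonic except for a charge at `y` of size at most `h y`.
    have hdef : ∀ z, -(h y * if z = y then 1 else 0) ≤ w z - s * kernelOp (walkKernel μ) w z := by
      intro z
      have e1 : kernelOp (walkKernel μ) w z = green (walkKernel μ) s 1 1 * (R⁻¹ * h z) -
          h y * kernelOp (walkKernel μ) (fun z => green (walkKernel μ) s z y) z := by
        rw [hw, hP.kernelOp_sub, hP.kernelOp_smul, hP.kernelOp_smul]
        beta_reduce
        rw [show kernelOp (walkKernel μ) h z = _ from hh z]
      have e2 := hP.green_eq hS z y
      have e3 : s * (green (walkKernel μ) s 1 1 * (R⁻¹ * h z)) ≤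
          green (walkKernel μ) s 1 1 * h z := by
        rw [show s * (green (walkKernel μ) s 1 1 * (R⁻¹ * h z)) =
          (s / R) * (green (walkKernel μ) s 1 1 * h z) by ring]
        exact mul_le_of_le_one_left (mul_nonneg hG.le (h0 z)) ((div_le_one hR).2 (le_of_lt hsR))
      rw [e1]
      simp only [hw]
      rw [e2]
      linarith
    -- Telescope over `n` steps from `y`: since `w y = 0`, the value `sⁿ Pⁿ w (y)` is at most the
    -- accumulated charge `D`, and it dominates `sⁿ Pⁿ(y, x) w(x)`.
    have hbound : w x ≤ D / c := by
      rw [le_div_iff₀ hc0]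
      have e1 := hP.sum_iterate_sub s w n y
      have e2 : -D ≤ ∑ k ∈ Finset.range n, s ^ k *
          (kernelOp (walkKernel μ))^[k] (fun z => w z - s * kernelOp (walkKernel μ) w z) y := by
        rw [hD, Finset.mul_sum, ← Finset.sum_neg_distrib]
        refine Finset.sum_le_sum fun k _ => ?_
        have e3 := hP.iterate_mono hdef k y
        have e4 := congrFun (hP.iterate_sum {y} (fun _ => -h y)
          (fun a z => if z = a then (1 : ℝ) else 0) k) y
        simp only [Finset.sum_singleton, ← IsFiniteKernel.stepProb_eq_iterate] at e4
        simp only [← neg_mul] at e3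
        rw [e4] at e3
        have e5 := hμ.stepProb_le_one k y y
        calc -(h y * R ^ k) ≤ s ^ k * (-h y) := by
              have := mul_le_mul_of_nonneg_left (pow_le_pow_left₀ hs0.le (le_of_lt hsR) k) hy.le
              linarith
          _ ≤ s ^ k * (-h y * stepProb (walkKernel μ) k y y) := by
              refine mul_le_mul_of_nonneg_left ?_ (pow_nonneg hs0.le k)
              nlinarith
          _ ≤ _ := mul_le_mul_of_nonneg_left e3 (pow_nonneg hs0.le k)
      have e6 : stepProb (walkKernel μ) n y x * w x ≤ (kernelOp (walkKernel μ))^[n] w y := by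
        rw [hP.iterate_eq]
        exact (hP.isFiniteKernel_stepProb n).mul_le_kernelOp hw0 y x
      calc w x * c = (R / 2) ^ n * (stepProb (walkKernel μ) n y x * w x) := by rw [hc]; ring
        _ ≤ s ^ n * (kernelOp (walkKernel μ))^[n] w y :=
            mul_le_mul (pow_le_pow_left₀ (half_pos hR).le hs.le n) e6
              (mul_nonneg hn.le (hw0 x)) (pow_nonneg hs0.le n)
        _ ≤ D := by rw [hwy] at e1; linarith
    have e7 : h x / h y - green (walkKernel μ) s x y / green (walkKernel μ) s 1 1 =
        w x / h y / green (walkKernel μ) s 1 1 := by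
      rw [hw]; field_simp
    rw [e7, abs_of_nonneg (div_nonneg (div_nonneg (hw0 x) hy.le) hG.le)]
    gcongr
  have hz := (hμ.tendsto_green_atTop hrec).const_div_atTop (D / c / h y)
  have := tendsto_const_nhds (x := h x / h y).sub (squeeze_zero_norm' (a := fun s =>
    D / c / h y / green (walkKernel μ) s 1 1) hev hz)
  simpa using this

/-- The limits `h(x)/h(y)` and `1/h(y)` of the normalised Green functions have a quotient
independent of `y`. -/
lemma walkMartinKernel_of_recurrent (hμ : IsLazyAdmissible μ)
    (hrec : ¬ Summable fun n : ℕ => convRadius μ ^ n * stepProb (walkKernel μ) n 1 1) {h : Γ → ℝ}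
    (h0 : ∀ x, 0 ≤ h x) (h1 : h 1 = 1) (hh : IsHarmonic (walkKernel μ) (convRadius μ)⁻¹ h)
    (x y : Γ) : walkMartinKernel μ (convRadius μ) x y = h x := by
  rw [walkMartinKernel, if_neg (lt_irrefl _)]
  refine Tendsto.limUnder_eq ?_
  have hR := hμ.convRadius_pos
  have hy := hμ.pos_of_harmonic (inv_pos.2 hR) h0 h1 hh y
  have := (hμ.tendsto_green_div_of_recurrent hrec h0 h1 hh x y).div
    (hμ.tendsto_green_div_of_recurrent hrec h0 h1 hh 1 y) (by rw [h1]; positivity)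
  rw [h1, div_div_div_cancel_right₀ hy.ne', div_one] at this
  refine this.congr' ?_
  filter_upwards [(hμ.tendsto_green_atTop hrec).eventually_gt_atTop 0] with s hs
  simp only [Pi.div_apply, greenRatio]
  rw [div_div_div_cancel_right₀ hs.ne']

/-- When the series converges at `R`, its terms there dominate those for `s < R`, and the limit
passes inside the sum. -/
lemma walkMartinKernel_of_transient (hμ : IsLazyAdmissible μ)
    (hs : Summable fun n : ℕ => convRadius μ ^ n * stepProb (walkKernel μ) n 1 1) :
    walkMartinKernel μ (convRadius μ) = greenRatio (walkKernel μ) 1 (convRadius μ) := by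
  have hR := hμ.convRadius_pos
  have key : ∀ x y, Tendsto (fun s => green (walkKernel μ) s x y) (𝓝[<] convRadius μ)
      (𝓝 (green (walkKernel μ) (convRadius μ) x y)) := fun x y => by
    refine tendsto_tsum_of_dominated_convergence (hμ.summable_green hR hs x y) (fun n => ?_) ?_
    · have : Continuous fun s : ℝ => s ^ n * stepProb (walkKernel μ) n x y := by fun_prop
      exact (this.tendsto _).mono_left nhdsWithin_le_nhds
    · filter_upwards [(eventually_gt_nhds hR).filter_mono nhdsWithin_le_nhds,
        self_mem_nhdsWithin] with s hs0 hsR n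
      have := hμ.isFiniteKernel.stepProb_nonneg n x y
      rw [Real.norm_of_nonneg (mul_nonneg (pow_nonneg hs0.le n) this)]
      exact mul_le_mul_of_nonneg_right (pow_le_pow_left₀ hs0.le (le_of_lt hsR) n) this
  ext x y
  rw [walkMartinKernel, if_neg (lt_irrefl _)]
  exact ((key x y).div (key 1 y) (hμ.green_pos hR hs 1 y).ne').limUnder_eq

theorem mem_martinBoundary_walk [Infinite Γ] (hμ : IsLazyAdmissible μ) {r : ℝ} (hr : 0 < r)
    {h : Γ → ℝ} (hmin : IsMinimalHarmonic (walkKernel μ) r⁻¹ 1 h) :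
    (h, 0) ∈ martinBoundary (walkMartinKernel μ r) := by
  have hrR := hμ.le_convRadius hr hmin.nonneg hmin.normalized hmin.harmonic
  have htrans : (Summable fun n : ℕ => r ^ n * stepProb (walkKernel μ) n 1 1) →
      (h, 0) ∈ martinBoundary (greenRatio (walkKernel μ) 1 r) := fun hs =>
    hμ.isFiniteKernel.mem_martinBoundary_of_isMinimalHarmonic hr (hμ.summable_green hr hs)
      (hμ.exists_stepProb_pos 1) hmin
  rcases hrR.lt_or_eq with hlt | rfl
  · have : walkMartinKernel μ r = greenRatio (walkKernel μ) 1 r := by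
      ext x y; rw [walkMartinKernel, if_pos hlt]
    rw [this]
    exact htrans (hμ.summable_of_lt_convRadius hr hlt)
  · by_cases hs : Summable fun n : ℕ => convRadius μ ^ n * stepProb (walkKernel μ) n 1 1
    · rw [hμ.walkMartinKernel_of_transient hs]
      exact htrans hs
    · refine mem_martinBoundary_of_approx fun F ε hε => ?_
      obtain ⟨y, hy⟩ := Infinite.exists_notMem_finset F
      refine ⟨y, hy, fun x _ => ?_⟩
      rw [hμ.walkMartinKernel_of_recurrent hs hmin.nonneg hmin.normalized hmin.harmonic, sub_self,
        abs_zero]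
      exact hε

/-! ### The truncated kernel -/

lemma truncKernel_apply (hμ : IsLazyAdmissible μ) (x y : Γ) :
    truncKernel μ x y = if wordNorm μ x + 1 = wordNorm μ y then μ (x⁻¹ * y) else 0 := by
  unfold truncKernel
  by_cases h : μ (x⁻¹ * y) = 0
  · simp [h]
  · have := hμ.wordNorm_le_succ h
    congr 1
    exact propext ⟨fun h' => le_antisymm h' this, fun h' => h'.le⟩

/-- Every step raises the norm by at least one. The Green series are thus finite sums, and the
truncated chain is transient. -/
lemma stepProb_trunc_eq_zero {n : ℕ} {x y : Γ} (h : wordNorm μ y < wordNorm μ x + n) :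
    stepProb (truncKernel μ) n x y = 0 := by
  induction n generalizing x with
  | zero => exact if_neg fun hxy => h.ne (by rw [hxy, add_zero])
  | succ n ih =>
    refine (tsum_congr fun z => ?_).trans tsum_zero
    by_cases hz : wordNorm μ x + 1 ≤ wordNorm μ z
    · rw [ih (by omega), mul_zero]
    · rw [truncKernel, if_neg hz, zero_mul]

/-- Along a shortest path to `x` the norm grows by exactly one at each step, so the path survives
truncation. -/
lemma exists_stepProb_trunc_pos (hμ : IsLazyAdmissible μ) (x : Γ) :
    ∃ n, 0 < stepProb (truncKernel μ) n 1 x := by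
  suffices H : ∀ n x, wordNorm μ x = n → 0 < stepProb (truncKernel μ) n 1 x from ⟨_, H _ x rfl⟩
  intro n
  induction n with
  | zero =>
    intro x hx
    have := hμ.stepProb_wordNorm_pos x
    rw [hx] at this
    exact this
  | succ n ih =>
    intro x hx
    have h1 := hμ.stepProb_wordNorm_pos x
    rw [hx] at h1
    obtain ⟨z, hz, hzx⟩ := hμ.exists_pred h1
    have h2 := wordNorm_le hz
    have h3 := hμ.wordNorm_le_succ hzx.ne'
    refine (mul_pos (ih z (by omega)) ?_).trans_le
      (hμ.isFiniteKernel_trunc.stepProb_mul_le n 1 1 z x)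
    rw [IsFiniteKernel.stepProb_one, truncKernel, if_pos (by omega)]
    exact hzx

theorem mem_martinBoundary_trunc (hμ : IsLazyAdmissible μ) {h : Γ → ℝ}
    (hmin : IsMinimalHarmonic (truncKernel μ) 1 1 h) :
    (h, 0) ∈ martinBoundary (greenRatio (truncKernel μ) 1 1) := by
  refine hμ.isFiniteKernel_trunc.mem_martinBoundary_of_isMinimalHarmonic one_pos (fun x y => ?_)
    hμ.exists_stepProb_trunc_pos (by rwa [inv_one])
  refine summable_of_ne_finset_zero (s := Finset.range (wordNorm μ y + 1)) fun n hn => ?_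
  rw [stepProb_trunc_eq_zero, mul_zero]
  simp only [Finset.mem_range] at hn
  omega

end IsLazyAdmissible

/-! ### Space-time harmonic functions and the rescaled walks. -/

/-- The walk weighted by `r^(|x| + 1 - |y|)`. Its harmonic functions are the functions
`x ↦ r^|x| h(x)` with `h` an `r⁻¹`-harmonic function of the walk if `r > 0`. -/
noncomputable def rescaledWalk {Γ : Type*} [Group Γ] (μ : Γ → ℝ) (r : ℝ) (x y : Γ) : ℝ :=
  r ^ (wordNorm μ x + 1 - wordNorm μ y) * μ (x⁻¹ * y)

namespace SpaceTime

variable {Γ : Type*} [Group Γ] {μ : Γ → ℝ}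

lemma ext_coord {p q : SpaceTime μ} (h1 : p.1.1 = q.1.1) (h2 : p.1.2 = q.1.2) : p = q :=
  Subtype.ext (Prod.ext h1 h2)

open Classical in
/-- Extension by zero of a function on the space-time set. -/
noncomputable def extend (g : SpaceTime μ → ℝ) (x : Γ) (m : ℕ) : ℝ :=
  if h : 0 < stepProb (walkKernel μ) m 1 x then g ⟨(x, m), h⟩ else 0

lemma extend_apply (g : SpaceTime μ → ℝ) (q : SpaceTime μ) : extend g q.1.1 q.1.2 = g q :=
  dif_pos q.2

/-- The space-time function `r^(m - |x|) H(x)`. -/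
noncomputable def lift (r : ℝ) (H : Γ → ℝ) (q : SpaceTime μ) : ℝ :=
  r ^ (q.1.2 - wordNorm μ q.1.1) * H q.1.1

lemma wordNorm_le (q : SpaceTime μ) : wordNorm μ q.1.1 ≤ q.1.2 :=
  IsLazyAdmissible.wordNorm_le q.2

end SpaceTime

namespace IsLazyAdmissible

variable {Γ : Type*} [Group Γ] {μ : Γ → ℝ}

/-- The space-time point `(x, m + 1)` after `(x, m)`. -/
def next (hμ : IsLazyAdmissible μ) (q : SpaceTime μ) : SpaceTime μ :=
  ⟨(q.1.1, q.1.2 + 1), hμ.stepProb_succ_pos q.2 (by rw [inv_mul_cancel]; exact hμ.lazy)⟩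

/-- The first space-time point `(x, |x|)` above `x`. -/
noncomputable def first (hμ : IsLazyAdmissible μ) (x : Γ) : SpaceTime μ :=
  ⟨(x, wordNorm μ x), hμ.stepProb_wordNorm_pos x⟩

lemma first_one (hμ : IsLazyAdmissible μ) : hμ.first 1 = SpaceTime.base μ :=
  SpaceTime.ext_coord rfl wordNorm_one

lemma lift_first (hμ : IsLazyAdmissible μ) (r : ℝ) (H : Γ → ℝ) (x : Γ) :
    SpaceTime.lift r H (hμ.first x) = H x := by
  simp [SpaceTime.lift, first]

lemma lift_next (hμ : IsLazyAdmissible μ) (r : ℝ) (H : Γ → ℝ) (q : SpaceTime μ) :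
    SpaceTime.lift r H (hμ.next q) = r * SpaceTime.lift r H q := by
  have := q.wordNorm_le
  simp only [SpaceTime.lift, next]
  rw [Nat.sub_add_comm this, pow_succ]
  ring

/-- The space-time points above `x` are the times `m ≥ |x|`, reached from `(x, |x|)` by repeated
shifts. -/
lemma eq_lift (hμ : IsLazyAdmissible μ) {r : ℝ} {g : SpaceTime μ → ℝ}
    (hg : ∀ q, g (hμ.next q) = r * g q) : g = SpaceTime.lift r fun x => g (hμ.first x) := by
  have key : ∀ x m (hm : 0 < stepProb (walkKernel μ) m 1 x),
      g ⟨(x, m), hm⟩ = r ^ (m - wordNorm μ x) * g (hμ.first x) := by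
    intro x m hm
    induction m, wordNorm_le hm using Nat.le_induction with
    | base => simp [first]
    | succ n hn ih =>
      have h := hμ.stepProb_pos_iff.2 hn
      rw [Nat.sub_add_comm hn, pow_succ', mul_assoc, ← ih h]
      exact hg ⟨(x, n), h⟩
  ext q
  exact key q.1.1 q.1.2 q.2

lemma isFiniteKernel_spaceTime (hμ : IsLazyAdmissible μ) :
    IsFiniteKernel (spaceTimeKernel μ) where
  nonneg p q := by unfold spaceTimeKernel; split_ifs; exacts [hμ.nonneg _, le_rfl]
  finite p := by
    refine (((hμ.isFiniteKernel.finite p.1.1).image fun y => (y, p.1.2 + 1)).preimage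
      (Subtype.val_injective (p := fun p : Γ × ℕ =>
        0 < stepProb (walkKernel μ) p.2 1 p.1)).injOn).subset fun q hq => ?_
    obtain ⟨h1, h2⟩ := Classical.not_imp.1 fun h => hq (ite_eq_right_iff.2 h)
    exact ⟨q.1.1, h2, Prod.ext rfl h1⟩

/-- Successors of a space-time point stay in the space-time set, so the sum over that set is a sum
over `Γ` at the next time. -/
lemma kernelOp_spaceTime (hμ : IsLazyAdmissible μ) (F : Γ → ℕ → ℝ) (p : SpaceTime μ) :
    kernelOp (spaceTimeKernel μ) (fun q => F q.1.1 q.1.2) p =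
      kernelOp (walkKernel μ) (fun y => F y (p.1.2 + 1)) p.1.1 := by
  set B : Γ × ℕ → ℝ := fun z =>
    (if p.1.2 + 1 = z.2 then μ (p.1.1⁻¹ * z.1) else 0) * F z.1 z.2 with hB
  have hBz : ∀ z, B z ≠ 0 → p.1.2 + 1 = z.2 ∧ μ (p.1.1⁻¹ * z.1) ≠ 0 := fun z hz => by
    have := left_ne_zero_of_mul hz
    simpa only [ne_eq, ite_eq_right_iff, Classical.not_imp] using this
  have h1 : kernelOp (spaceTimeKernel μ) (fun q => F q.1.1 q.1.2) p =
      ∑' z, Set.indicator {p : Γ × ℕ | 0 < stepProb (walkKernel μ) p.2 1 p.1} B z :=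
    tsum_subtype {p : Γ × ℕ | 0 < stepProb (walkKernel μ) p.2 1 p.1} B
  rw [h1, Set.indicator_eq_self.2, ← Function.Injective.tsum_eq
    (g := fun y : Γ => (y, p.1.2 + 1)) (fun a b h => congrArg Prod.fst h)]
  · simp [hB, kernelOp, walkKernel]
  · intro z hz
    exact ⟨z.1, Prod.ext rfl (hBz z hz).1⟩
  · intro z hz
    obtain ⟨h2, h3⟩ := hBz z hz
    change 0 < stepProb (walkKernel μ) z.2 1 z.1
    rw [← h2]
    exact hμ.stepProb_succ_pos p.2 ((hμ.nonneg _).lt_of_ne' h3)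

lemma kernelOp_spaceTime_next (hμ : IsLazyAdmissible μ) (g : SpaceTime μ → ℝ) (p : SpaceTime μ) :
    kernelOp (spaceTimeKernel μ) (fun q => g (hμ.next q)) p =
      kernelOp (spaceTimeKernel μ) g (hμ.next p) := by
  have h1 : g = fun q => SpaceTime.extend g q.1.1 q.1.2 :=
    funext fun q => (SpaceTime.extend_apply g q).symm
  have h2 : (fun q => g (hμ.next q)) = fun q => SpaceTime.extend g q.1.1 (q.1.2 + 1) :=
    funext fun q => (SpaceTime.extend_apply g (hμ.next q)).symm
  rw [h2, hμ.kernelOp_spaceTime fun x m => SpaceTime.extend g x (m + 1)]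
  conv_rhs => rw [h1, hμ.kernelOp_spaceTime]
  rfl

lemma isHarmonic_next (hμ : IsLazyAdmissible μ) {g : SpaceTime μ → ℝ}
    (hg : IsHarmonic (spaceTimeKernel μ) 1 g) :
    IsHarmonic (spaceTimeKernel μ) 1 fun q => g (hμ.next q) := fun p =>
  (hμ.kernelOp_spaceTime_next g p).trans (hg (hμ.next p))

/-- Keep only the term of the harmonic sum in which the walk stays put. -/
lemma mul_next_le (hμ : IsLazyAdmissible μ) {g : SpaceTime μ → ℝ} (h0 : ∀ q, 0 ≤ g q)
    (hg : IsHarmonic (spaceTimeKernel μ) 1 g) (q : SpaceTime μ) :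
    μ 1 * g (hμ.next q) ≤ g q := by
  have h1 := hμ.isFiniteKernel_spaceTime.mul_le_kernelOp h0 q (hμ.next q)
  rw [show kernelOp (spaceTimeKernel μ) g q = _ from hg q, one_mul] at h1
  simpa [spaceTimeKernel, next] using h1

lemma kernelOp_lift (hμ : IsLazyAdmissible μ) (r : ℝ) (H : Γ → ℝ) (p : SpaceTime μ) :
    kernelOp (spaceTimeKernel μ) (SpaceTime.lift r H) p =
      r ^ (p.1.2 - wordNorm μ p.1.1) * kernelOp (rescaledWalk μ r) H p.1.1 := by
  refine (hμ.kernelOp_spaceTime (fun y m => r ^ (m - wordNorm μ y) * H y) p).trans ?_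
  rw [kernelOp, kernelOp, ← tsum_mul_left]
  refine tsum_congr fun y => ?_
  by_cases hy : μ (p.1.1⁻¹ * y) = 0
  · simp [walkKernel, rescaledWalk, hy]
  · have h1 := hμ.wordNorm_le_succ hy
    have h2 := p.wordNorm_le
    rw [walkKernel, rescaledWalk, show p.1.2 + 1 - wordNorm μ y =
      (p.1.2 - wordNorm μ p.1.1) + (wordNorm μ p.1.1 + 1 - wordNorm μ y) by omega, pow_add]
    ring

/-- The equation at `(x, m)` is `r^(m-|x|)` times the one at `(x, |x|)`, where that factor is `1`
even for `r = 0`. -/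
lemma isHarmonic_lift_iff (hμ : IsLazyAdmissible μ) {r : ℝ} {H : Γ → ℝ} :
    IsHarmonic (spaceTimeKernel μ) 1 (SpaceTime.lift r H) ↔ IsHarmonic (rescaledWalk μ r) 1 H := by
  constructor
  · intro h x
    have h1 := (hμ.kernelOp_lift r H (hμ.first x)).symm.trans (h (hμ.first x))
    rw [hμ.lift_first] at h1
    simp only [first, Nat.sub_self, pow_zero, one_mul] at h1
    rw [one_mul]
    exact h1
  · intro h p
    refine (hμ.kernelOp_lift r H p).trans ?_
    rw [show kernelOp (rescaledWalk μ r) H p.1.1 = _ from h p.1.1, SpaceTime.lift]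
    ring

/-- If `f(x, m + 1) = r f(x, m)`, the same holds for all harmonic functions between `0` and `f`:
it holds for the extreme points of the set of these functions. -/
lemma next_eq_of_le (hμ : IsLazyAdmissible μ) {r : ℝ} (hr : 0 ≤ r) {f g : SpaceTime μ → ℝ}
    (hf : IsHarmonic (spaceTimeKernel μ) 1 f) (hfr : ∀ q, f (hμ.next q) = r * f q)
    (hg0 : ∀ q, 0 ≤ g q) (hg : IsHarmonic (spaceTimeKernel μ) 1 g) (hgf : ∀ q, g q ≤ f q)
    (q : SpaceTime μ) : g (hμ.next q) = r * g q := by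
  have hP := hμ.isFiniteKernel_spaceTime
  rcases hr.eq_or_lt with rfl | hr
  · have h1 := hgf (hμ.next q)
    rw [hfr, zero_mul] at h1
    rw [zero_mul]
    exact le_antisymm h1 (hg0 _)
  set S : Set (SpaceTime μ → ℝ) :=
    {g | (∀ q, g q ∈ Set.Icc 0 (f q)) ∧ IsHarmonic (spaceTimeKernel μ) 1 g} with hS
  have hop : ∀ (a b : ℝ) (u v : SpaceTime μ → ℝ), IsHarmonic (spaceTimeKernel μ) 1 u →
      IsHarmonic (spaceTimeKernel μ) 1 v →
      IsHarmonic (spaceTimeKernel μ) 1 fun q => a * u q + b * v q := by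
    intro a b u v hu hv p
    change kernelOp _ _ _ = _
    rw [hP.kernelOp_add, hP.kernelOp_smul, hP.kernelOp_smul]
    beta_reduce
    rw [show kernelOp (spaceTimeKernel μ) u p = _ from hu p,
      show kernelOp (spaceTimeKernel μ) v p = _ from hv p]
    ring
  have hconv : Convex ℝ S := by
    intro u hu v hv a b ha hb hab
    refine ⟨fun q => convex_Icc 0 (f q) (hu.1 q) (hv.1 q) ha hb hab, hop a b u v hu.2 hv.2⟩
  have hcomp : IsCompact S := by
    have h1 : IsCompact (Set.pi Set.univ fun q => Set.Icc 0 (f q)) :=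
      isCompact_univ_pi fun q => isCompact_Icc
    have h2 : IsClosed {g : SpaceTime μ → ℝ | IsHarmonic (spaceTimeKernel μ) 1 g} := by
      simp only [IsHarmonic, Set.ofPred_forall]
      refine isClosed_iInter fun p => isClosed_eq ?_ (by fun_prop)
      have : (fun g : SpaceTime μ → ℝ => ∑' y, spaceTimeKernel μ p y * g y) =
          fun g => ∑ y ∈ hP.row p, spaceTimeKernel μ p y * g y :=
        funext fun g => hP.kernelOp_eq_sum g p
      rw [this]
      fun_prop
    convert h1.inter_right h2 using 1
    ext g
    exact and_congr_left' (by simp only [Set.mem_pi, Set.mem_univ, true_imp_iff])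
  set T : Set (SpaceTime μ → ℝ) := {g | ∀ q, g (hμ.next q) = r * g q} with hT
  have hTclosed : IsClosed T := by
    simp only [hT, Set.ofPred_forall]
    exact isClosed_iInter fun q => isClosed_eq (by fun_prop) (by fun_prop)
  have hTconv : Convex ℝ T := by
    intro u hu v hv a b _ _ _ q
    simp only [Pi.add_apply, Pi.smul_apply, smul_eq_mul]
    rw [hu q, hv q]
    ring
  have hext : S.extremePoints ℝ ⊆ T := by
    intro u hu
    rw [mem_extremePoints] at hu
    obtain ⟨⟨hu1, hu2⟩, hu3⟩ := hu
    -- `δ / r ≤ μ 1` keeps `v - (δ/r) v∘next` non-negative for non-negative harmonic `v`; `δ ≤ 1`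
    -- keeps `(1 - δ) u` non-negative.
    set δ := min (μ 1 * r) 1 with hδ
    have hδ0 : 0 < δ := lt_min (mul_pos hμ.lazy hr) one_pos
    have hδ1 : δ ≤ 1 := min_le_right _ _
    have hδμ : δ / r ≤ μ 1 := (div_le_iff₀ hr).2 (min_le_left _ _)
    have hb : ∀ v : SpaceTime μ → ℝ, (∀ q, 0 ≤ v q) → IsHarmonic (spaceTimeKernel μ) 1 v →
        ∀ q, δ / r * v (hμ.next q) ≤ v q := fun v hv0 hv q =>
      (mul_le_mul_of_nonneg_right hδμ (hv0 _)).trans (hμ.mul_next_le hv0 hv q)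
    have hδr : 0 < δ / r := div_pos hδ0 hr
    have hcr : ∀ q, δ / r * f (hμ.next q) = δ * f q := fun q => by rw [hfr]; field_simp
    have hharm := hμ.isHarmonic_next hu2
    -- The extreme point `u` is the midpoint of this function and the one in `h2`. Upper bounds by
    -- `f` use `f∘next = r f`, and for `h2` also the inequality `hb` applied to `f - u`. Equality
    -- with `u` gives `u∘next = r u`.
    have h1 : (fun q => (1 - δ) * u q + δ / r * u (hμ.next q)) ∈ S := by
      refine ⟨fun q => ⟨?_, ?_⟩, hop _ _ _ _ hu2 hharm⟩
      · exact add_nonneg (mul_nonneg (sub_nonneg.2 hδ1) (hu1 q).1)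
          (mul_nonneg hδr.le (hu1 _).1)
      · have e1 := mul_le_mul_of_nonneg_left (hu1 q).2 (sub_nonneg.2 hδ1)
        have e2 := mul_le_mul_of_nonneg_left (hu1 (hμ.next q)).2 hδr.le
        have e3 := hcr q
        linarith
    have h2 : (fun q => (1 + δ) * u q + (-(δ / r)) * u (hμ.next q)) ∈ S := by
      refine ⟨fun q => ⟨?_, ?_⟩, hop _ _ _ _ hu2 hharm⟩
      · have e1 := hb u (fun q => (hu1 q).1) hu2 q
        have e2 := mul_nonneg hδ0.le (hu1 q).1
        linarith
      · have e1 := hb (fun q => 1 * f q + (-1) * u q)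
          (fun q => by have := (hu1 q).2; linarith) (hop _ _ _ _ hf hu2) q
        have e2 := hcr q
        have e3 := mul_le_mul_of_nonneg_left (hu1 q).2 hδ0.le
        linarith
    have h3 := (hu3 _ h1 _ h2 ⟨1 / 2, 1 / 2, by norm_num, by norm_num, by norm_num, by
      ext q
      simp only [Pi.add_apply, Pi.smul_apply, smul_eq_mul]
      ring⟩).1
    intro q
    have h4 := congrFun h3 q
    have h5 : δ / r * (u (hμ.next q) - r * u q) = 0 := by
      have : δ / r * (r * u q) = δ * u q := by field_simp
      rw [mul_sub, this]
      linarith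
    exact sub_eq_zero.1 ((mul_eq_zero.1 h5).resolve_left hδr.ne')
  -- Krein–Milman: `T` is closed and convex and contains the extreme points of `S`.
  have hsub : S ⊆ T := by
    rw [← closure_convexHull_extremePoints hcomp hconv]
    exact closure_minimal (convexHull_min hext hTconv) hTclosed
  exact hsub ⟨fun q => ⟨hg0 q, hgf q⟩, hg⟩ q

/-- Competitors for `H` lift to competitors for the lift. Conversely, by `next_eq_of_le`, every
space-time competitor is itself a lift with the same `r`. -/
theorem isMinimalHarmonic_lift_iff (hμ : IsLazyAdmissible μ) {r : ℝ} (hr : 0 ≤ r) {H : Γ → ℝ} :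
    IsMinimalHarmonic (spaceTimeKernel μ) 1 (SpaceTime.base μ) (SpaceTime.lift r H) ↔
      IsMinimalHarmonic (rescaledWalk μ r) 1 1 H := by
  have hlift : ∀ {k : Γ → ℝ} {C : ℝ}, (∀ x, k x ≤ C * H x) →
      ∀ q : SpaceTime μ, SpaceTime.lift r k q ≤ C * SpaceTime.lift r H q := fun hk q => by
    rw [SpaceTime.lift, SpaceTime.lift, mul_left_comm]
    exact mul_le_mul_of_nonneg_left (hk _) (pow_nonneg hr _)
  constructor
  · intro h
    refine ⟨fun x => hμ.lift_first r H x ▸ h.nonneg _, hμ.isHarmonic_lift_iff.1 h.harmonic, ?_,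
      fun k hk0 hk ⟨C, hC, hkC⟩ => ?_⟩
    · have := h.normalized
      rwa [← hμ.first_one, hμ.lift_first] at this
    · obtain ⟨c, hc0, hc⟩ := h.minimal (SpaceTime.lift r k)
        (fun q => mul_nonneg (pow_nonneg hr _) (hk0 _)) (hμ.isHarmonic_lift_iff.2 hk)
        ⟨C, hC, hlift hkC⟩
      refine ⟨c, hc0, fun x => ?_⟩
      have := hc (hμ.first x)
      rwa [hμ.lift_first, hμ.lift_first] at this
  · intro h
    have hH := hμ.isHarmonic_lift_iff.2 h.harmonic
    refine ⟨fun q => mul_nonneg (pow_nonneg hr _) (h.nonneg _), hH, ?_,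
      fun g hg0 hg ⟨C, hC, hgC⟩ => ?_⟩
    · rw [← hμ.first_one, hμ.lift_first, h.normalized]
    · have hCH : (fun q => C * SpaceTime.lift (μ := μ) r H q) =
          SpaceTime.lift r fun x => C * H x := by
        ext q; simp only [SpaceTime.lift]; ring
      have hCharm : IsHarmonic (spaceTimeKernel μ) 1 fun q => C * SpaceTime.lift r H q := by
        intro p
        change kernelOp _ _ _ = _
        rw [hμ.isFiniteKernel_spaceTime.kernelOp_smul]
        beta_reduce
        rw [show kernelOp (spaceTimeKernel μ) (SpaceTime.lift r H) p = _ from hH p]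
        ring
      have hgl := hμ.eq_lift (hμ.next_eq_of_le hr hCharm
        (fun q => by rw [hμ.lift_next]; ring) hg0 hg hgC)
      rw [hgl] at hg
      obtain ⟨c, hc0, hc⟩ := h.minimal _ (fun x => hg0 _) (hμ.isHarmonic_lift_iff.1 hg)
        ⟨C, hC, fun x => (hgC _).trans_eq (by rw [hμ.lift_first])⟩
      refine ⟨c, hc0, fun q => ?_⟩
      rw [congrFun hgl q, SpaceTime.lift, SpaceTime.lift, hc]
      ring

/-- A minimal space-time harmonic function has the form `r^(m - |x|) H(x)`. -/
lemma eq_lift_of_isMinimalHarmonic (hμ : IsLazyAdmissible μ) {f : SpaceTime μ → ℝ}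
    (hf : IsMinimalHarmonic (spaceTimeKernel μ) 1 (SpaceTime.base μ) f) :
    0 ≤ f (hμ.next (SpaceTime.base μ)) ∧
      f = SpaceTime.lift (f (hμ.next (SpaceTime.base μ))) fun x => f (hμ.first x) := by
  refine ⟨hf.nonneg _, hμ.eq_lift ?_⟩
  -- The shift is harmonic and at most `μ(e)⁻¹ f`, hence a multiple of `f`; the base point
  -- identifies the factor.
  obtain ⟨c, -, hc⟩ := hf.minimal (fun q => f (hμ.next q)) (fun q => hf.nonneg _)
    (hμ.isHarmonic_next hf.harmonic) ⟨(μ 1)⁻¹, inv_pos.2 hμ.lazy, fun q => by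
      rw [← div_eq_inv_mul, le_div_iff₀ hμ.lazy, mul_comm]
      exact hμ.mul_next_le hf.nonneg hf.harmonic q⟩
  have h1 := hc (SpaceTime.base μ)
  rw [hf.normalized, mul_one] at h1
  intro q
  rw [h1]
  exact hc q

/-- Since `0 ^ 0 = 1`, exactly the steps that raise the norm by one survive. -/
lemma rescaledWalk_zero (hμ : IsLazyAdmissible μ) : rescaledWalk μ 0 = truncKernel μ := by
  ext x y
  rw [hμ.truncKernel_apply, rescaledWalk]
  by_cases h : μ (x⁻¹ * y) = 0
  · simp [h]
  · have := hμ.wordNorm_le_succ h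
    split_ifs with h1
    · rw [h1, Nat.sub_self, pow_zero, one_mul]
    · rw [zero_pow (by omega), zero_mul]

lemma kernelOp_rescaledWalk (hμ : IsLazyAdmissible μ) {r : ℝ} (k : Γ → ℝ) (x : Γ) :
    kernelOp (rescaledWalk μ r) (fun y => r ^ wordNorm μ y * k y) x =
      r ^ wordNorm μ x * (r * kernelOp (walkKernel μ) k x) := by
  rw [kernelOp, kernelOp, ← tsum_mul_left, ← tsum_mul_left]
  refine tsum_congr fun y => ?_
  by_cases h : μ (x⁻¹ * y) = 0
  · simp [rescaledWalk, walkKernel, h]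
  · have h1 := hμ.wordNorm_le_succ h
    have h2 : r ^ (wordNorm μ x + 1 - wordNorm μ y) * r ^ wordNorm μ y = r ^ wordNorm μ x * r := by
      rw [← pow_add, Nat.sub_add_cancel h1, pow_succ]
    rw [rescaledWalk, walkKernel]
    linear_combination μ (x⁻¹ * y) * k y * h2

lemma isHarmonic_rescaledWalk_iff (hμ : IsLazyAdmissible μ) {r : ℝ} (hr : 0 < r) {k : Γ → ℝ} :
    IsHarmonic (rescaledWalk μ r) 1 (fun x => r ^ wordNorm μ x * k x) ↔
      IsHarmonic (walkKernel μ) r⁻¹ k := by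
  refine forall_congr' fun x => ?_
  change kernelOp _ _ _ = _ ↔ kernelOp _ _ _ = _
  rw [hμ.kernelOp_rescaledWalk, one_mul, mul_right_inj' (pow_pos hr _).ne', eq_inv_mul_iff_mul_eq₀
    hr.ne']

/-- Multiplication by the positive function `r^|x|` is an order isomorphism of the two cones of
harmonic functions, and it is `1` at `e`. -/
theorem isMinimalHarmonic_rescaledWalk_iff (hμ : IsLazyAdmissible μ) {r : ℝ} (hr : 0 < r)
    {k : Γ → ℝ} :
    IsMinimalHarmonic (rescaledWalk μ r) 1 1 (fun x => r ^ wordNorm μ x * k x) ↔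
      IsMinimalHarmonic (walkKernel μ) r⁻¹ 1 k := by
  have hpos : ∀ x, 0 < r ^ wordNorm μ x := fun x => pow_pos hr _
  constructor
  · intro h
    refine ⟨fun x => nonneg_of_mul_nonneg_right (h.nonneg x) (hpos x),
      (hμ.isHarmonic_rescaledWalk_iff hr).1 h.harmonic,
      by simpa [wordNorm_one] using h.normalized, fun g hg0 hg ⟨C, hC, hgC⟩ => ?_⟩
    obtain ⟨c, hc0, hc⟩ := h.minimal (fun x => r ^ wordNorm μ x * g x)
      (fun x => mul_nonneg (hpos x).le (hg0 x)) ((hμ.isHarmonic_rescaledWalk_iff hr).2 hg)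
      ⟨C, hC, fun x => by
        rw [mul_left_comm]; exact mul_le_mul_of_nonneg_left (hgC x) (hpos x).le⟩
    refine ⟨c, hc0, fun x => mul_left_cancel₀ (hpos x).ne' ?_⟩
    rw [hc x]; ring
  · intro h
    refine ⟨fun x => mul_nonneg (hpos x).le (h.nonneg x),
      (hμ.isHarmonic_rescaledWalk_iff hr).2 h.harmonic,
      by simpa [wordNorm_one] using h.normalized, fun g hg0 hg ⟨C, hC, hgC⟩ => ?_⟩
    have hg' : g = fun x => r ^ wordNorm μ x * ((r ^ wordNorm μ x)⁻¹ * g x) :=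
      funext fun x => (mul_inv_cancel_left₀ (hpos x).ne' _).symm
    rw [hg'] at hg
    obtain ⟨c, hc0, hc⟩ := h.minimal _
      (fun x => mul_nonneg (inv_pos.2 (hpos x)).le (hg0 x))
      ((hμ.isHarmonic_rescaledWalk_iff hr).1 hg)
      ⟨C, hC, fun x => by
        rw [← div_eq_inv_mul, div_le_iff₀ (hpos x)]
        exact (hgC x).trans_eq (by ring)⟩
    refine ⟨c, hc0, fun x => ?_⟩
    rw [congrFun hg' x, hc x]
    ring

/-- The space-time points are accessible from the base point. -/
lemma exists_stepProb_spaceTime_pos (hμ : IsLazyAdmissible μ) (p : SpaceTime μ) :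
    ∃ n, 0 < stepProb (spaceTimeKernel μ) n (SpaceTime.base μ) p := by
  obtain ⟨⟨x, m⟩, hp⟩ := p
  refine ⟨m, ?_⟩
  induction m generalizing x with
  | zero =>
    have h1 : (1 : Γ) = x := by
      by_contra h
      simp [stepProb, h] at hp
    subst h1
    change 0 < stepProb (spaceTimeKernel μ) 0 (SpaceTime.base μ) (SpaceTime.base μ)
    simp [stepProb]
  | succ m ih =>
    obtain ⟨z, hz, hzx⟩ := hμ.exists_pred hp
    refine (mul_pos (ih z hz) ?_).trans_le
      (hμ.isFiniteKernel_spaceTime.stepProb_mul_le m 1 _ ⟨(z, m), hz⟩ _)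
    rw [IsFiniteKernel.stepProb_one]
    exact hzx.trans_eq (if_pos rfl).symm

/-- Time advances by one at each step, which makes the space-time chain transient. -/
lemma stepProb_spaceTime_eq_zero {n : ℕ} {p q : SpaceTime μ} (h : q.1.2 < p.1.2 + n) :
    stepProb (spaceTimeKernel μ) n p q = 0 := by
  induction n generalizing p with
  | zero => exact if_neg fun hpq => h.ne (by rw [hpq, add_zero])
  | succ n ih =>
    refine (tsum_congr fun z => ?_).trans tsum_zero
    by_cases hz : p.1.2 + 1 = z.1.2
    · rw [ih (by omega), mul_zero]
    · rw [spaceTimeKernel, if_neg hz, zero_mul]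

theorem mem_martinBoundary_spaceTime (hμ : IsLazyAdmissible μ) {f : SpaceTime μ → ℝ}
    (hf : IsMinimalHarmonic (spaceTimeKernel μ) 1 (SpaceTime.base μ) f) :
    (f, 0) ∈ martinBoundary (greenRatio (spaceTimeKernel μ) (SpaceTime.base μ) 1) := by
  refine hμ.isFiniteKernel_spaceTime.mem_martinBoundary_of_isMinimalHarmonic one_pos
    (fun p q => ?_) hμ.exists_stepProb_spaceTime_pos (by rwa [inv_one])
  refine summable_of_ne_finset_zero (s := Finset.range (q.1.2 + 1)) fun n hn => ?_
  rw [stepProb_spaceTime_eq_zero, mul_zero]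
  simp only [Finset.mem_range] at hn
  omega

end IsLazyAdmissible

/-! ### The homeomorphism. -/

namespace MinimalBoundaryUnion

variable {Γ : Type*} [Group Γ] {μ : Γ → ℝ}

lemma snd_point (p : MinimalBoundaryUnion μ) : p.point.2 = 0 := by
  have h := p.point_mem
  unfold minimalBoundaryAt at h
  split_ifs at h
  exacts [snd_eq_zero_of_mem_martinBoundary h.1, snd_eq_zero_of_mem_martinBoundary h.1]

lemma isMinimalHarmonic_rescaledKernel (hμ : IsLazyAdmissible μ) (p : MinimalBoundaryUnion μ) :
    IsMinimalHarmonic (rescaledWalk μ p.param) 1 1 p.rescaledKernel := by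
  have h := p.point_mem
  by_cases h0 : p.param = 0
  · rw [minimalBoundaryAt, if_pos h0] at h
    have : p.rescaledKernel = p.point.1 := funext fun x => if_pos h0
    rw [h0, hμ.rescaledWalk_zero, this]
    exact h.2
  · rw [minimalBoundaryAt, if_neg h0] at h
    have : p.rescaledKernel = fun x => p.param ^ wordNorm μ x * p.point.1 x :=
      funext fun x => if_neg h0
    rw [this, hμ.isMinimalHarmonic_rescaledWalk_iff (p.param_mem.1.lt_of_ne' h0)]
    exact h.2

/-- At parameter `0` the factor `0^(m-|x|)` is the indicator of `m = |x|`; otherwise the powers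
combine to `r^m`. -/
lemma lift_rescaledKernel (p : MinimalBoundaryUnion μ) (q : SpaceTime μ) :
    SpaceTime.lift p.param p.rescaledKernel q = p.spaceTimeFun q.1.1 q.1.2 := by
  have hq := q.wordNorm_le
  unfold SpaceTime.lift rescaledKernel spaceTimeFun
  split_ifs with h0 h1
  · rw [h1, Nat.sub_self, pow_zero, one_mul]
  · rw [h0, zero_pow (by omega), zero_mul]
  · rw [← mul_assoc, ← pow_add, Nat.sub_add_cancel hq]

lemma ext_of_rescaledKernel {p q : MinimalBoundaryUnion μ} (h1 : p.param = q.param)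
    (h2 : p.rescaledKernel = q.rescaledKernel) : p = q := by
  have h3 : p.point = q.point := by
    refine Prod.ext (funext fun x => ?_) (p.snd_point.trans q.snd_point.symm)
    have h4 := congrFun h2 x
    unfold rescaledKernel at h4
    rw [← h1] at h4
    split_ifs at h4 with h0
    · exact h4
    · exact mul_left_cancel₀ (pow_ne_zero _ h0) h4
  cases p; cases q
  simp only at h1 h3
  subst h1 h3
  rfl

/-- The point of the union with parameter `r` and rescaled kernel `H`. -/
lemma exists_rescaledKernel_eq [Infinite Γ] (hμ : IsLazyAdmissible μ) {r : ℝ} (hr : 0 ≤ r)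
    {H : Γ → ℝ} (hH : IsMinimalHarmonic (rescaledWalk μ r) 1 1 H) :
    ∃ p : MinimalBoundaryUnion μ, p.param = r ∧ p.rescaledKernel = H := by
  rcases hr.eq_or_lt with rfl | hr
  · rw [hμ.rescaledWalk_zero] at hH
    refine ⟨⟨0, ⟨le_rfl, hμ.convRadius_pos.le⟩, (H, 0), ?_⟩, rfl, funext fun x => if_pos rfl⟩
    rw [minimalBoundaryAt, if_pos rfl]
    exact ⟨hμ.mem_martinBoundary_trunc hH, hH⟩
  · have hH' : H = fun x => r ^ wordNorm μ x * ((r ^ wordNorm μ x)⁻¹ * H x) :=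
      funext fun x => (mul_inv_cancel_left₀ (pow_pos hr _).ne' _).symm
    rw [hH', hμ.isMinimalHarmonic_rescaledWalk_iff hr] at hH
    refine ⟨⟨r, ⟨hr.le, hμ.le_convRadius hr hH.nonneg hH.normalized hH.harmonic⟩,
      (fun x => (r ^ wordNorm μ x)⁻¹ * H x, 0), ?_⟩, rfl, funext fun x => ?_⟩
    · rw [minimalBoundaryAt, if_neg hr.ne']
      exact ⟨hμ.mem_martinBoundary_walk hr hH, hH⟩
    · rw [rescaledKernel, if_neg hr.ne']
      exact (congrFun hH' x).symm

/-- The space-time boundary point of a point of the union. -/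
noncomputable def toSpaceTime (hμ : IsLazyAdmissible μ) (p : MinimalBoundaryUnion μ) :
    minimalSpaceTimeBoundary μ :=
  have h := (hμ.isMinimalHarmonic_lift_iff p.param_mem.1).2 (p.isMinimalHarmonic_rescaledKernel hμ)
  ⟨(SpaceTime.lift p.param p.rescaledKernel, 0), hμ.mem_martinBoundary_spaceTime h, h⟩

/-- The point of the union of a space-time boundary point. -/
lemma exists_ofSpaceTime [Infinite Γ] (hμ : IsLazyAdmissible μ)
    (η : minimalSpaceTimeBoundary μ) : ∃ p : MinimalBoundaryUnion μ,
      p.param = η.1.1 (hμ.next (SpaceTime.base μ)) ∧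
        p.rescaledKernel = fun x => η.1.1 (hμ.first x) := by
  obtain ⟨h0, h1⟩ := hμ.eq_lift_of_isMinimalHarmonic η.2.2
  have h2 := η.2.2
  rw [h1, hμ.isMinimalHarmonic_lift_iff h0] at h2
  exact exists_rescaledKernel_eq hμ h0 h2

/-- The homeomorphism between the minimal space-time Martin boundary and the disjoint union of the
minimal Martin boundaries. -/
noncomputable def homeomorph [Infinite Γ] (hμ : IsLazyAdmissible μ) :
    minimalSpaceTimeBoundary μ ≃ₜ MinimalBoundaryUnion μ where
  toFun η := (exists_ofSpaceTime hμ η).choose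
  invFun := toSpaceTime hμ
  left_inv η := by
    obtain ⟨h1, h2⟩ := (exists_ofSpaceTime hμ η).choose_spec
    refine Subtype.ext (Prod.ext ?_ (snd_eq_zero_of_mem_martinBoundary η.2.1).symm)
    simp only [toSpaceTime]
    rw [h1, h2]
    exact (hμ.eq_lift_of_isMinimalHarmonic η.2.2).2.symm
  right_inv p := by
    obtain ⟨h1, h2⟩ := (exists_ofSpaceTime hμ (toSpaceTime hμ p)).choose_spec
    have hp := p.isMinimalHarmonic_rescaledKernel hμ
    refine ext_of_rescaledKernel (h1.trans ?_) (h2.trans (funext fun x => ?_))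
    · simp only [toSpaceTime]
      rw [hμ.lift_next, ← hμ.first_one, hμ.lift_first, hp.normalized, mul_one]
    · exact hμ.lift_first _ _ x
  continuous_toFun := by
    have hspec := fun η => (exists_ofSpaceTime hμ η).choose_spec
    -- Both coordinates are evaluations of the space-time kernel, at `(e, 1)` and at `(x, |x|)`.
    refine continuous_induced_rng.2 (Continuous.prodMk ?_ (continuous_pi fun x => ?_))
    · simp only [(hspec _).1]
      fun_prop
    · simp only [(hspec _).2]
      fun_prop
  continuous_invFun := by
    have h : Continuous fun p : MinimalBoundaryUnion μ =>
        ((p.param, p.rescaledKernel) : ℝ × (Γ → ℝ)) := continuous_induced_dom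
    refine Continuous.subtype_mk (Continuous.prodMk (continuous_pi fun q => ?_)
      continuous_const) _
    -- The exponent `m - |x|` is a natural number, so continuity holds up to and including `r = 0`.
    exact (h.fst.pow _).mul ((continuous_apply _).comp h.snd)

lemma eq_spaceTimeFun_homeomorph [Infinite Γ] (hμ : IsLazyAdmissible μ)
    (η : minimalSpaceTimeBoundary μ) (q : SpaceTime μ) :
    η.1.1 q = (homeomorph hμ η).spaceTimeFun q.1.1 q.1.2 := by
  rw [← lift_rescaledKernel]
  conv_lhs => rw [← (homeomorph hμ).symm_apply_apply η]
  rfl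

end MinimalBoundaryUnion

theorem theorem6p6 {Γ : Type*} [Group Γ] [Countable Γ] [Infinite Γ] (μ : Γ → ℝ)
    (hμ_nonneg : ∀ x, 0 ≤ μ x) (hμ_sum : HasSum μ 1)
    (hμ_finite : (Function.support μ).Finite)
    (hμ_admissible : Subsemigroup.closure (Function.support μ) = ⊤)
    (hμ_lazy : 0 < μ 1) :
    ∃ Φ : minimalSpaceTimeBoundary μ ≃ₜ MinimalBoundaryUnion μ,
      ∀ (η : minimalSpaceTimeBoundary μ) (p : SpaceTime μ),
        η.1.1 p = (Φ η).spaceTimeFun p.1.1 p.1.2 :=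
  have hμ : IsLazyAdmissible μ := ⟨hμ_nonneg, hμ_sum, hμ_finite, hμ_admissible, hμ_lazy⟩
  ⟨MinimalBoundaryUnion.homeomorph hμ, MinimalBoundaryUnion.eq_spaceTimeFun_homeomorph hμ⟩
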